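/- All vector spaces are over $\mathbb{C}$; $\Delta,\varepsilon,S$ denote coproduct, counit and antipode, $\Delta a=a_1\otimes a_2$, and left coactions are written $v\mapsto v^{(1)}\otimes v^{(2)}$. A *coquasitriangular* structure on a Hopf algebra $H$ is a convolution-invertible linear map $\mathcal R:H\otimes H\to\mathbb{C}$ with $\mathcal R(ab\otimes c)=\mathcal R(a\otimes c_1)\mathcal R(b\otimes c_2)$, $\mathcal R(a\otimes bc)=\mathcal R(a_1\otimes c)\mathcal R(a_2\otimes b)$ and $b_1a_1\,\mathcal R(a_2\otimes b_2)=\mathcal R(a_1\otimes b_1)\,a_2b_2$; it is *cotriangular* if moreover $\mathcal R(a_1\otimes b_1)\mathcal R(b_2\otimes a_2)=\varepsilon(a)\varepsilon(b)$. It braids the category of left $H$-comodules by $\psi(v\otimes w)=\mathcal R(w^{(1)}\otimes v^{(1)})\,w^{(2)}\otimes v^{(2)}$. A homomorphism $\pi:A\to H$ of coquasitriangular Hopf algebras is a Hopf algebra homomorphism with $\mathcal R_A=\mathcal R_H\circ(\pi\otimes\pi)$. Let $C(\mathbb{Z}_2)$ be the Hopf algebra with basis $1,g$, where $g^2=1$,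 $\Delta g=g\otimes g$, $\varepsilon(g)=1$, $Sg=g$, and let $C'(\mathbb{Z}_2)$ be $C(\mathbb{Z}_2)$ equipped with the Bose–Fermi cotriangular structure $\mathcal R(g^i\otimes g^j)=(-1)^{ij}$; thus left $C'(\mathbb{Z}_2)$-comodules are $\mathbb{Z}_2$-graded vector spaces with the super braiding. Let $H$ be a Hopf algebra with cotriangular structure $\mathcal R$ and let $B$ be a braided Hopf algebra in the category of left $H$-comodules (the structure maps are comodule maps, and $\Delta\circ\cdot=(\cdot\otimes\cdot)(\mathrm{id}\otimes\psi\otimes\mathrm{id})(\Delta\otimes\Delta)$) which is braided commutative ($\cdot=\cdot\circ\psi$). Its *bosonization* $B\rtimes H$ is the Hopf algebra $B\otimes H$ with unit $1\otimes 1$, counit $\varepsilon\otimes\varepsilon$, $$(b\otimes h)(c\otimes k)=\mathcal R(c^{(1)}\otimes h_1)\,bc^{(2)}\otimes h_2k,\qquad \Delta(b\otimes h)=(b_1\otimes b_2{}^{(1)}h_1)\otimes(b_2{}^{(2)}\otimes h_2),$$ $$S(b\otimes h)=\mathcal R\big((S_Bb^{(2)})^{(1)}\otimes (S_H(b^{(1)}h))_1\big)\,(S_Bb^{(2)})^{(2)}\otimes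 (S_H(b^{(1)}h))_2,$$ the cotriangular structure $(b\otimes h)\otimes(c\otimes k)\mapsto\mathcal R(h\otimes k)\varepsilon(b)\varepsilon(c)$, and the projection $B\rtimes H\to H$, $b\otimes h\mapsto\varepsilon(b)h$. Given moreover a surjection $\sigma:B\twoheadrightarrow H$ of braided Hopf algebras, where $H$ (assumed braided commutative) carries the trivial coaction $h\mapsto 1\otimes h$, put $\tilde\sigma=\sigma\otimes\mathrm{id}:B\rtimes H\to H\otimes H$ and $\Delta^2=(\mathrm{id}\otimes\Delta)\Delta$. The *spin-statistics reduction* of $B\rtimes H$ is the largest subspace $W\subseteq B\rtimes H$ with $$(\mathrm{id}\otimes\tilde\sigma\otimes\mathrm{id})\,\Delta^2(W)\subseteq W\otimes\big(\Delta H\cap\tau(\Delta H)\big)\otimes W,$$ $\tau$ being the flip of $H\otimes H$. **Theorem.** Let $A$ be a coquasitriangular Hopf algebra and $\pi:A\twoheadrightarrow C'(\mathbb{Z}_2)$ a surjective homomorphism of coquasitriangular Hopf algebras. Then there are a $\mathbb{Z}_2$-graded commutative $\mathbb{Z}_2$-graded Hopf algebra $B$ (that is, a braided commutative braided Hopf algebra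 in the category of left $C'(\mathbb{Z}_2)$-comodules) and a surjective homomorphism $\sigma:B\twoheadrightarrow C(\mathbb{Z}_2)$ of $\mathbb{Z}_2$-graded Hopf algebras, where $C(\mathbb{Z}_2)$ is trivially graded, such that $A$ is the spin-statistics reduction of $B\rtimes C'(\mathbb{Z}_2)$: there is an injective homomorphism $\iota:A\to B\rtimes C'(\mathbb{Z}_2)$ of coquasitriangular Hopf algebras whose image is the spin-statistics reduction and whose composition with the projection $B\rtimes C'(\mathbb{Z}_2)\to C'(\mathbb{Z}_2)$ is $\pi$. -/

import Mathlib

open scoped TensorProduct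

universe u

namespace SpinStat

/-! Throughout the base field is `ℂ`, `H` is a Hopf algebra, and a bilinear form on `H` is
written in curried form, `R h k` standing for `R(h ⊗ k)`. Sweedler notation is used in the
doc comments: `Δ a = a₁ ⊗ a₂`, and `v ↦ v⁽¹⁾ ⊗ v⁽²⁾` for a left coaction. -/

section Coquasitriangular

/-- The convolution product of two linear functionals on a coalgebra,
`(f * g)(c) = f(c₁) g(c₂)`. -/
noncomputable def conv {C : Type*} [AddCommGroup C] [Module ℂ C] [Coalgebra ℂ C]
    (f g : C →ₗ[ℂ] ℂ) : C →ₗ[ℂ] ℂ :=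
  LinearMap.mul' ℂ ℂ ∘ₗ TensorProduct.map f g ∘ₗ Coalgebra.comul

/-- `R` is a coquasitriangular structure on the Hopf algebra `H`. -/
structure IsCoquasitriangular {H : Type*} [Ring H] [HopfAlgebra ℂ H]
    (R : H →ₗ[ℂ] H →ₗ[ℂ] ℂ) : Prop where
  /-- `R` is invertible for the convolution product of functionals on `H ⊗ H`. -/
  exists_inverse : ∃ R' : H ⊗[ℂ] H →ₗ[ℂ] ℂ,
    conv (TensorProduct.lift R) R' = Coalgebra.counit ∧
    conv R' (TensorProduct.lift R) = Coalgebra.counit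
  /-- `R(a b ⊗ c) = R(a ⊗ c₁) R(b ⊗ c₂)`. -/
  mul_left : ∀ a b : H, R (a * b) = conv (R a) (R b)
  /-- `R(a ⊗ b c) = R(a₁ ⊗ c) R(a₂ ⊗ b)`. -/
  mul_right : ∀ b c : H, R.flip (b * c) = conv (R.flip c) (R.flip b)
  /-- `b₁ a₁ R(a₂ ⊗ b₂) = R(a₁ ⊗ b₁) a₂ b₂`, both sides being functions of `a ⊗ b`. -/
  quasi_comm :
    (TensorProduct.rid ℂ H).toLinearMap ∘ₗ
      TensorProduct.map (LinearMap.mul' ℂ H ∘ₗ (TensorProduct.comm ℂ H H).toLinearMap)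
        (TensorProduct.lift R) ∘ₗ (Coalgebra.comul : H ⊗[ℂ] H →ₗ[ℂ] _) =
    (TensorProduct.lid ℂ H).toLinearMap ∘ₗ
      TensorProduct.map (TensorProduct.lift R) (LinearMap.mul' ℂ H) ∘ₗ
        (Coalgebra.comul : H ⊗[ℂ] H →ₗ[ℂ] _)

/-- `R` is a cotriangular structure: coquasitriangular with
`R(a₁ ⊗ b₁) R(b₂ ⊗ a₂) = ε(a) ε(b)`. -/
structure IsCotriangular {H : Type*} [Ring H] [HopfAlgebra ℂ H]
    (R : H →ₗ[ℂ] H →ₗ[ℂ] ℂ) : Prop extends IsCoquasitriangular R where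
  symmetric : conv (TensorProduct.lift R) (TensorProduct.lift R.flip) = Coalgebra.counit

/-- `π : A ↠ H` is a solution of the quantum group extension problem for `(H, RH)`:
`(A, RA)` is a coquasitriangular Hopf algebra, and `π` is a surjective homomorphism of
coquasitriangular Hopf algebras. -/
structure IsQuantumGroupExtension {H : Type*} [Ring H] [HopfAlgebra ℂ H]
    (RH : H →ₗ[ℂ] H →ₗ[ℂ] ℂ) {A : Type*} [Ring A] [HopfAlgebra ℂ A]
    (RA : A →ₗ[ℂ] A →ₗ[ℂ] ℂ) (π : A →ₐc[ℂ] H) : Prop where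
  coquasitriangular : IsCoquasitriangular RA
  surjective : Function.Surjective π
  map_R : ∀ a b : A, RA a b = RH (π a) (π b)

end Coquasitriangular

section Comodules

/-- `δ` is a left coaction of `H` on the vector space `V`. -/
structure IsLeftCoaction {H : Type*} [Ring H] [HopfAlgebra ℂ H]
    {V : Type*} [AddCommGroup V] [Module ℂ V] (δ : V →ₗ[ℂ] H ⊗[ℂ] V) : Prop where
  /-- `Δ(v⁽¹⁾) ⊗ v⁽²⁾ = v⁽¹⁾ ⊗ δ(v⁽²⁾)`. -/
  coassoc : (TensorProduct.assoc ℂ H H V).toLinearMap ∘ₗ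
      TensorProduct.map Coalgebra.comul LinearMap.id ∘ₗ δ =
    TensorProduct.map LinearMap.id δ ∘ₗ δ
  /-- `ε(v⁽¹⁾) v⁽²⁾ = v`. -/
  counit : (TensorProduct.lid ℂ V).toLinearMap ∘ₗ
      TensorProduct.map Coalgebra.counit LinearMap.id ∘ₗ δ = LinearMap.id

/-- The trivial coaction `v ↦ 1 ⊗ v`. -/
noncomputable def trivialCoaction (H : Type*) [Ring H] [HopfAlgebra ℂ H]
    (V : Type*) [AddCommGroup V] [Module ℂ V] : V →ₗ[ℂ] H ⊗[ℂ] V :=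
  TensorProduct.mk ℂ H V 1

/-- `f : V → W` is a comodule map. -/
def IsColinear {H : Type*} [Ring H] [HopfAlgebra ℂ H]
    {V W : Type*} [AddCommGroup V] [Module ℂ V] [AddCommGroup W] [Module ℂ W]
    (δV : V →ₗ[ℂ] H ⊗[ℂ] V) (δW : W →ₗ[ℂ] H ⊗[ℂ] W) (f : V →ₗ[ℂ] W) : Prop :=
  δW ∘ₗ f = TensorProduct.map LinearMap.id f ∘ₗ δV

/-- The coaction on a tensor product of comodules,
`v ⊗ w ↦ v⁽¹⁾ w⁽¹⁾ ⊗ (v⁽²⁾ ⊗ w⁽²⁾)`. -/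
noncomputable def tensorCoaction {H : Type*} [Ring H] [HopfAlgebra ℂ H]
    {V W : Type*} [AddCommGroup V] [Module ℂ V] [AddCommGroup W] [Module ℂ W]
    (δV : V →ₗ[ℂ] H ⊗[ℂ] V) (δW : W →ₗ[ℂ] H ⊗[ℂ] W) :
    V ⊗[ℂ] W →ₗ[ℂ] H ⊗[ℂ] (V ⊗[ℂ] W) :=
  TensorProduct.map (LinearMap.mul' ℂ H) LinearMap.id ∘ₗ
    (TensorProduct.tensorTensorTensorComm ℂ H V H W).toLinearMap ∘ₗ
      TensorProduct.map δV δW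

/-- The braiding of left comodules,
`ψ(v ⊗ w) = R(w⁽¹⁾ ⊗ v⁽¹⁾) w⁽²⁾ ⊗ v⁽²⁾`. -/
noncomputable def braiding {H : Type*} [Ring H] [HopfAlgebra ℂ H]
    (R : H →ₗ[ℂ] H →ₗ[ℂ] ℂ)
    {V W : Type*} [AddCommGroup V] [Module ℂ V] [AddCommGroup W] [Module ℂ W]
    (δV : V →ₗ[ℂ] H ⊗[ℂ] V) (δW : W →ₗ[ℂ] H ⊗[ℂ] W) :
    V ⊗[ℂ] W →ₗ[ℂ] W ⊗[ℂ] V :=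
  (TensorProduct.lid ℂ (W ⊗[ℂ] V)).toLinearMap ∘ₗ
    TensorProduct.map (TensorProduct.lift R.flip) (TensorProduct.comm ℂ V W).toLinearMap ∘ₗ
      (TensorProduct.tensorTensorTensorComm ℂ H V H W).toLinearMap ∘ₗ
        TensorProduct.map δV δW

/-- `id ⊗ f ⊗ id`, with the brackets `(P ⊗ X) ⊗ (Y ⊗ Q) → (P ⊗ Y') ⊗ (X' ⊗ Q)`. -/
noncomputable def applyMiddle {P X Y X' Y' Q : Type*}
    [AddCommGroup P] [Module ℂ P] [AddCommGroup X] [Module ℂ X] [AddCommGroup Y] [Module ℂ Y]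
    [AddCommGroup X'] [Module ℂ X'] [AddCommGroup Y'] [Module ℂ Y']
    [AddCommGroup Q] [Module ℂ Q] (f : X ⊗[ℂ] Y →ₗ[ℂ] Y' ⊗[ℂ] X') :
    (P ⊗[ℂ] X) ⊗[ℂ] (Y ⊗[ℂ] Q) →ₗ[ℂ] (P ⊗[ℂ] Y') ⊗[ℂ] (X' ⊗[ℂ] Q) :=
  (TensorProduct.assoc ℂ P Y' (X' ⊗[ℂ] Q)).symm.toLinearMap ∘ₗ
    TensorProduct.map LinearMap.id
      ((TensorProduct.assoc ℂ Y' X' Q).toLinearMap ∘ₗ TensorProduct.map f LinearMap.id ∘ₗ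
        (TensorProduct.assoc ℂ X Y Q).symm.toLinearMap) ∘ₗ
      (TensorProduct.assoc ℂ P X (Y ⊗[ℂ] Q)).toLinearMap

/-- The product `(m ⊗ m) ∘ (id ⊗ ψ ⊗ id)` on the tensor product of two algebras that carry
left coactions: `(c ⊗ d)(c' ⊗ d') = c ψ(d ⊗ c') d'`. -/
noncomputable def braidedTensorMul {H : Type*} [Ring H] [HopfAlgebra ℂ H]
    (R : H →ₗ[ℂ] H →ₗ[ℂ] ℂ)
    {C D : Type*} [Ring C] [Algebra ℂ C] [Ring D] [Algebra ℂ D]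
    (δC : C →ₗ[ℂ] H ⊗[ℂ] C) (δD : D →ₗ[ℂ] H ⊗[ℂ] D) :
    (C ⊗[ℂ] D) ⊗[ℂ] (C ⊗[ℂ] D) →ₗ[ℂ] C ⊗[ℂ] D :=
  TensorProduct.map (LinearMap.mul' ℂ C) (LinearMap.mul' ℂ D) ∘ₗ
    applyMiddle (braiding R δD δC)

end Comodules

section BraidedHopf

/-- `B`, with coaction `δ` and antipode `S`, is a braided Hopf algebra in the category of
left `H`-comodules, braided by `R`. -/
structure IsBraidedHopfAlgebra {H : Type*} [Ring H] [HopfAlgebra ℂ H]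
    (R : H →ₗ[ℂ] H →ₗ[ℂ] ℂ) {B : Type*} [Ring B] [Algebra ℂ B] [Coalgebra ℂ B]
    (δ : B →ₗ[ℂ] H ⊗[ℂ] B) (S : B →ₗ[ℂ] B) : Prop where
  coaction : IsLeftCoaction δ
  /-- The unit is a comodule map. -/
  one_colinear : δ 1 = 1 ⊗ₜ[ℂ] 1
  /-- The product is a comodule map. -/
  mul_colinear : IsColinear (tensorCoaction δ δ) δ (LinearMap.mul' ℂ B)
  /-- The counit is a comodule map. -/
  counit_colinear : IsColinear δ (trivialCoaction H ℂ) Coalgebra.counit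
  /-- The coproduct is a comodule map. -/
  comul_colinear : IsColinear δ (tensorCoaction δ δ) Coalgebra.comul
  /-- The antipode is a comodule map. -/
  antipode_colinear : IsColinear δ δ S
  counit_one : Coalgebra.counit (R := ℂ) (1 : B) = 1
  counit_mul : ∀ b c : B, Coalgebra.counit (R := ℂ) (b * c) =
    Coalgebra.counit (R := ℂ) b * Coalgebra.counit (R := ℂ) c
  comul_one : Coalgebra.comul (R := ℂ) (1 : B) = 1 ⊗ₜ[ℂ] 1
  /-- `Δ ∘ m = (m ⊗ m) ∘ (id ⊗ ψ ⊗ id) ∘ (Δ ⊗ Δ)`. -/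
  comul_mul : (Coalgebra.comul : B →ₗ[ℂ] B ⊗[ℂ] B) ∘ₗ LinearMap.mul' ℂ B =
    braidedTensorMul R δ δ ∘ₗ TensorProduct.map Coalgebra.comul Coalgebra.comul
  /-- `S(b₁) b₂ = ε(b) 1`. -/
  antipode_left : LinearMap.mul' ℂ B ∘ₗ TensorProduct.map S LinearMap.id ∘ₗ
    Coalgebra.comul = Algebra.linearMap ℂ B ∘ₗ Coalgebra.counit
  /-- `b₁ S(b₂) = ε(b) 1`. -/
  antipode_right : LinearMap.mul' ℂ B ∘ₗ TensorProduct.map LinearMap.id S ∘ₗ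
    Coalgebra.comul = Algebra.linearMap ℂ B ∘ₗ Coalgebra.counit

/-- The algebra `B` with coaction `δ` is braided commutative, `m = m ∘ ψ`. -/
def IsBraidedCommutative {H : Type*} [Ring H] [HopfAlgebra ℂ H]
    (R : H →ₗ[ℂ] H →ₗ[ℂ] ℂ) {B : Type*} [Ring B] [Algebra ℂ B]
    (δ : B →ₗ[ℂ] H ⊗[ℂ] B) : Prop :=
  LinearMap.mul' ℂ B = LinearMap.mul' ℂ B ∘ₗ braiding R δ δ

/-- `f : B → K` is a homomorphism of braided Hopf algebras. -/
structure IsBraidedHopfHom {H : Type*} [Ring H] [HopfAlgebra ℂ H]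
    {B : Type*} [Ring B] [Algebra ℂ B] [Coalgebra ℂ B]
    {K : Type*} [Ring K] [Algebra ℂ K] [Coalgebra ℂ K]
    (δB : B →ₗ[ℂ] H ⊗[ℂ] B) (SB : B →ₗ[ℂ] B)
    (δK : K →ₗ[ℂ] H ⊗[ℂ] K) (SK : K →ₗ[ℂ] K) (f : B →ₗ[ℂ] K) : Prop where
  colinear : IsColinear δB δK f
  map_one : f 1 = 1
  map_mul : ∀ b c : B, f (b * c) = f b * f c
  counit_comp : Coalgebra.counit ∘ₗ f = (Coalgebra.counit : B →ₗ[ℂ] ℂ)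
  comul_comp : Coalgebra.comul ∘ₗ f =
    TensorProduct.map f f ∘ₗ (Coalgebra.comul : B →ₗ[ℂ] B ⊗[ℂ] B)
  antipode_comp : SK ∘ₗ f = f ∘ₗ SB

/-- `σ : B ↠ K` is a solution of the triangular group extension problem for `K` in the
category of left comodules of the cotriangular Hopf algebra `(H, R)`: `B` and `K` are braided
commutative braided Hopf algebras in it and `σ` is a surjective homomorphism between them. -/
structure IsTriangularGroupExtension {H : Type*} [Ring H] [HopfAlgebra ℂ H]
    (R : H →ₗ[ℂ] H →ₗ[ℂ] ℂ)
    {B : Type*} [Ring B] [Algebra ℂ B] [Coalgebra ℂ B]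
    {K : Type*} [Ring K] [Algebra ℂ K] [Coalgebra ℂ K]
    (δB : B →ₗ[ℂ] H ⊗[ℂ] B) (SB : B →ₗ[ℂ] B)
    (δK : K →ₗ[ℂ] H ⊗[ℂ] K) (SK : K →ₗ[ℂ] K) (σ : B →ₗ[ℂ] K) : Prop where
  cotriangular : IsCotriangular R
  hopf_source : IsBraidedHopfAlgebra R δB SB
  comm_source : IsBraidedCommutative R δB
  hopf_target : IsBraidedHopfAlgebra R δK SK
  comm_target : IsBraidedCommutative R δK
  hom : IsBraidedHopfHom δB SB δK SK σ
  surjective : Function.Surjective σ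

end BraidedHopf

section Bosonization

/-! The bosonization `B ⋊ H` has `B ⊗ H` as its underlying vector space, unit `1 ⊗ 1` and the
following structure maps. -/

/-- The product `(b ⊗ h)(c ⊗ g) = R(c⁽¹⁾ ⊗ h₁) b c⁽²⁾ ⊗ h₂ g` of `B ⋊ H`
(`H` being seen as a left comodule over itself by its coproduct). -/
noncomputable def bosMul {H : Type*} [Ring H] [HopfAlgebra ℂ H]
    (R : H →ₗ[ℂ] H →ₗ[ℂ] ℂ) {B : Type*} [Ring B] [Algebra ℂ B]
    (δ : B →ₗ[ℂ] H ⊗[ℂ] B) : (B ⊗[ℂ] H) ⊗[ℂ] (B ⊗[ℂ] H) →ₗ[ℂ] B ⊗[ℂ] H :=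
  braidedTensorMul R δ (Coalgebra.comul : H →ₗ[ℂ] H ⊗[ℂ] H)

/-- The map `b ⊗ h ↦ b⁽¹⁾ h ⊗ b⁽²⁾`. -/
noncomputable def coactMul {H : Type*} [Ring H] [HopfAlgebra ℂ H]
    {B : Type*} [AddCommGroup B] [Module ℂ B] (δ : B →ₗ[ℂ] H ⊗[ℂ] B) :
    B ⊗[ℂ] H →ₗ[ℂ] H ⊗[ℂ] B :=
  TensorProduct.map (LinearMap.mul' ℂ H) LinearMap.id ∘ₗ
    (TensorProduct.rightComm ℂ H B H).toLinearMap ∘ₗ TensorProduct.map δ LinearMap.id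

/-- The coproduct `Δ(b ⊗ h) = (b₁ ⊗ b₂⁽¹⁾ h₁) ⊗ (b₂⁽²⁾ ⊗ h₂)` of `B ⋊ H`. -/
noncomputable def bosComul {H : Type*} [Ring H] [HopfAlgebra ℂ H]
    {B : Type*} [Ring B] [Algebra ℂ B] [Coalgebra ℂ B] (δ : B →ₗ[ℂ] H ⊗[ℂ] B) :
    B ⊗[ℂ] H →ₗ[ℂ] (B ⊗[ℂ] H) ⊗[ℂ] (B ⊗[ℂ] H) :=
  applyMiddle (coactMul δ) ∘ₗ TensorProduct.map Coalgebra.comul Coalgebra.comul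

/-- The counit `ε(b ⊗ h) = ε(b) ε(h)` of `B ⋊ H`. -/
noncomputable def bosCounit (B H : Type*) [Ring H] [HopfAlgebra ℂ H]
    [Ring B] [Algebra ℂ B] [Coalgebra ℂ B] : B ⊗[ℂ] H →ₗ[ℂ] ℂ :=
  LinearMap.mul' ℂ ℂ ∘ₗ TensorProduct.map Coalgebra.counit Coalgebra.counit

/-- The antipode `b ⊗ h ↦ R((S_B b⁽²⁾)⁽¹⁾ ⊗ (S_H(b⁽¹⁾ h))₁) (S_B b⁽²⁾)⁽²⁾ ⊗ (S_H(b⁽¹⁾ h))₂`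
of `B ⋊ H`. -/
noncomputable def bosAntipode {H : Type*} [Ring H] [HopfAlgebra ℂ H]
    (R : H →ₗ[ℂ] H →ₗ[ℂ] ℂ) {B : Type*} [Ring B] [Algebra ℂ B]
    (δ : B →ₗ[ℂ] H ⊗[ℂ] B) (S : B →ₗ[ℂ] B) : B ⊗[ℂ] H →ₗ[ℂ] B ⊗[ℂ] H :=
  braiding R (Coalgebra.comul : H →ₗ[ℂ] H ⊗[ℂ] H) δ ∘ₗ
    TensorProduct.map (HopfAlgebra.antipode ℂ) S ∘ₗ coactMul δ

/-- The projection `B ⋊ H → H`, `b ⊗ h ↦ ε(b) h`. -/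
noncomputable def bosProj (B H : Type*) [Ring H] [HopfAlgebra ℂ H]
    [Ring B] [Algebra ℂ B] [Coalgebra ℂ B] : B ⊗[ℂ] H →ₗ[ℂ] H :=
  (TensorProduct.lid ℂ H).toLinearMap ∘ₗ TensorProduct.map Coalgebra.counit LinearMap.id

/-- The form `(b ⊗ h) ⊗ (c ⊗ g) ↦ R(h ⊗ g) ε(b) ε(c)` on `B ⋊ H`, i.e. the pull-back of `R`
along the projection `B ⋊ H → H`. -/
noncomputable def bosR {H : Type*} [Ring H] [HopfAlgebra ℂ H]
    (R : H →ₗ[ℂ] H →ₗ[ℂ] ℂ) (B : Type*) [Ring B] [Algebra ℂ B] [Coalgebra ℂ B] :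
    B ⊗[ℂ] H →ₗ[ℂ] B ⊗[ℂ] H →ₗ[ℂ] ℂ :=
  R.compl₁₂ (bosProj B H) (bosProj B H)

end Bosonization

section SpinStatistics

/-- The subspace `Δ H ∩ τ(Δ H)` of `H ⊗ H`, where `τ` is the transposition map. -/
noncomputable def diagonalPart (H : Type*) [Ring H] [HopfAlgebra ℂ H] :
    Submodule ℂ (H ⊗[ℂ] H) :=
  LinearMap.range (Coalgebra.comul : H →ₗ[ℂ] H ⊗[ℂ] H) ⊓
    (LinearMap.range (Coalgebra.comul : H →ₗ[ℂ] H ⊗[ℂ] H)).map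
      (TensorProduct.comm ℂ H H).toLinearMap

/-- The condition `(id ⊗ σ~ ⊗ id)(Δ² W) ⊆ W ⊗ (Δ H ∩ τ(Δ H)) ⊗ W` on a subspace `W` of
`B ⋊ H`, where `σ~ = σ ⊗ id : B ⋊ H → H ⊗ H` is the map induced by `σ : B → H`, and
`Δ² = (id ⊗ Δ) ∘ Δ` is the iterated coproduct of `B ⋊ H`. -/
def SatisfiesSpinStatistics {H : Type*} [Ring H] [HopfAlgebra ℂ H]
    {B : Type*} [Ring B] [Algebra ℂ B] [Coalgebra ℂ B]
    (δ : B →ₗ[ℂ] H ⊗[ℂ] B) (σ : B →ₗ[ℂ] H) (W : Submodule ℂ (B ⊗[ℂ] H)) : Prop :=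
  W.map
      (TensorProduct.map (LinearMap.id : B ⊗[ℂ] H →ₗ[ℂ] B ⊗[ℂ] H)
          (TensorProduct.map (TensorProduct.map σ (LinearMap.id : H →ₗ[ℂ] H))
            (LinearMap.id : B ⊗[ℂ] H →ₗ[ℂ] B ⊗[ℂ] H)) ∘ₗ
        TensorProduct.map (LinearMap.id : B ⊗[ℂ] H →ₗ[ℂ] B ⊗[ℂ] H) (bosComul δ) ∘ₗ
          bosComul δ) ≤
    LinearMap.range
      (TensorProduct.map W.subtype (TensorProduct.map (diagonalPart H).subtype W.subtype))

/-- `W` is the spin-statistics reduction of `B ⋊ H` with respect to `σ : B ↠ H`: the largest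
subspace with the above property. -/
def IsSpinStatisticsReduction {H : Type*} [Ring H] [HopfAlgebra ℂ H]
    {B : Type*} [Ring B] [Algebra ℂ B] [Coalgebra ℂ B]
    (δ : B →ₗ[ℂ] H ⊗[ℂ] B) (σ : B →ₗ[ℂ] H) (W : Submodule ℂ (B ⊗[ℂ] H)) : Prop :=
  IsGreatest {W' | SatisfiesSpinStatistics δ σ W'} W

/-- `ι` identifies the quantum group extension `π : A → H`, with coquasitriangular structure
`RA`, with the spin-statistics reduction of the bosonization `B ⋊ H`: it is an injective
homomorphism of coquasitriangular Hopf algebras over `H` whose image is the spin-statistics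
reduction. -/
structure IsIsoOntoReduction {H : Type*} [Ring H] [HopfAlgebra ℂ H]
    (R : H →ₗ[ℂ] H →ₗ[ℂ] ℂ) {A : Type*} [Ring A] [HopfAlgebra ℂ A]
    (RA : A →ₗ[ℂ] A →ₗ[ℂ] ℂ) (π : A →ₐc[ℂ] H)
    {B : Type*} [Ring B] [Algebra ℂ B] [Coalgebra ℂ B]
    (δ : B →ₗ[ℂ] H ⊗[ℂ] B) (S : B →ₗ[ℂ] B) (σ : B →ₗ[ℂ] H)
    (ι : A →ₗ[ℂ] B ⊗[ℂ] H) : Prop where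
  injective : Function.Injective ι
  map_one : ι 1 = 1 ⊗ₜ[ℂ] 1
  map_mul : ∀ a b : A, ι (a * b) = bosMul R δ (ι a ⊗ₜ[ℂ] ι b)
  counit_comp : bosCounit B H ∘ₗ ι = Coalgebra.counit
  comul_comp : bosComul δ ∘ₗ ι = TensorProduct.map ι ι ∘ₗ Coalgebra.comul
  antipode_comp : bosAntipode R δ S ∘ₗ ι = ι ∘ₗ HopfAlgebra.antipode ℂ
  map_R : ∀ a b : A, RA a b = bosR R B (ι a) (ι b)
  proj_comp : ∀ a : A, bosProj B H (ι a) = π a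
  range_eq : IsSpinStatisticsReduction δ σ (LinearMap.range ι)

end SpinStatistics

section CZ2

/-- The Hopf algebra `C(ℤ₂)`: it has the basis `1, g` with `g² = 1`, `Δ g = g ⊗ g`, `ε(g) = 1`,
`S g = g`, where `gⁱ` is `AddMonoidAlgebra.single i 1` for `i : ZMod 2`. -/
abbrev CZ2 : Type := AddMonoidAlgebra ℂ (ZMod 2)

/-- The Bose-Fermi cotriangular structure of `C(ℤ₂)`: `R(gⁱ ⊗ gʲ) = (-1)^(i j)`. -/
noncomputable def superR : CZ2 →ₗ[ℂ] CZ2 →ₗ[ℂ] ℂ :=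
  LinearMap.compl₁₂
    (Finsupp.lsum ℂ fun i : ZMod 2 => LinearMap.toSpanSingleton ℂ _
      (Finsupp.lsum ℂ fun j : ZMod 2 => LinearMap.toSpanSingleton ℂ ℂ
        ((-1 : ℂ) ^ (i.val * j.val))))
    (AddMonoidAlgebra.coeffLinearEquiv ℂ).toLinearMap
    (AddMonoidAlgebra.coeffLinearEquiv ℂ).toLinearMap

theorem superR_single (i j : ZMod 2) (a b : ℂ) :
    superR (AddMonoidAlgebra.single i a) (AddMonoidAlgebra.single j b) =
      a * b * (-1 : ℂ) ^ (i.val * j.val) := by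
  simp [superR, AddMonoidAlgebra.coeffLinearEquiv, mul_assoc]

theorem sign_sq (i j : ZMod 2) :
    (-1 : ℂ) ^ (i.val * j.val) * (-1 : ℂ) ^ (i.val * j.val) = 1 := by
  rw [← pow_add, Even.neg_one_pow ⟨_, rfl⟩]

theorem sign_add (i j k : ZMod 2) : (-1 : ℂ) ^ ((i + j).val * k.val) =
    (-1 : ℂ) ^ (i.val * k.val) * (-1 : ℂ) ^ (j.val * k.val) := by
  have h : ∀ i j k : ZMod 2, (-1 : ℤ) ^ ((i + j).val * k.val) =
    (-1 : ℤ) ^ (i.val * k.val) * (-1 : ℤ) ^ (j.val * k.val) := by decide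
  exact_mod_cast h i j k

/-- `superR` is indeed a cotriangular structure. -/
theorem superR_isCotriangular : IsCotriangular superR where
  exists_inverse := by
    refine ⟨TensorProduct.lift superR, ?_, ?_⟩ <;>
    · ext i j
      simp [conv, superR_single, TensorProduct.comul_tmul, TensorProduct.counit_tmul, sign_sq]
  mul_left := by
    intro a b
    induction a using AddMonoidAlgebra.induction_linear with
    | zero => ext; simp [conv]
    | add f g hf hg => simp [add_mul, hf, hg, conv, TensorProduct.map_add_left, LinearMap.add_comp, LinearMap.comp_add]
    | single i r =>
    induction b using AddMonoidAlgebra.induction_linear with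
    | zero => ext; simp [conv]
    | add f g hf hg => simp [mul_add, hf, hg, conv, TensorProduct.map_add_right, LinearMap.add_comp, LinearMap.comp_add]
    | single j s =>
      ext k
      simp [conv, superR_single, AddMonoidAlgebra.single_mul_single]
      rw [sign_add]; ring
  mul_right := by
    intro a b
    induction a using AddMonoidAlgebra.induction_linear with
    | zero => ext; simp [conv]
    | add f g hf hg => simp [add_mul, hf, hg, conv, TensorProduct.map_add_right, LinearMap.add_comp, LinearMap.comp_add]
    | single i r =>
    induction b using AddMonoidAlgebra.induction_linear with
    | zero => ext; simp [conv]
    | add f g hf hg => simp [mul_add, hf, hg, conv, TensorProduct.map_add_left, LinearMap.add_comp, LinearMap.comp_add]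
    | single j s =>
      ext k
      simp [conv, superR_single, AddMonoidAlgebra.single_mul_single]
      rw [mul_comm k.val, sign_add, mul_comm k.val, mul_comm k.val]; ring
  quasi_comm := by
    ext i j : 5
    simp [superR_single, TensorProduct.comul_tmul, AddMonoidAlgebra.single_mul_single, add_comm]
  symmetric := by
    ext i j
    simp [conv, superR_single, TensorProduct.comul_tmul, TensorProduct.counit_tmul, mul_comm j.val, sign_sq]

end CZ2

end SpinStat

open SpinStat

namespace SpinStat

open TensorProduct

/-! Coacting through `π` on both sides splits `A` into pieces A_{ij}, on which π(a₁) ⊗ a₂ = gⁱ ⊗ a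
and a₁ ⊗ π(a₂) = a ⊗ gʲ. This bigrading behaves like matrix indices: products add bidegrees, Δ maps
A_{ij} into ⊕ₘ A_{im} ⊗ A_{mj}, S maps A_{ij} into A_{ji}, and ε and `π` vanish on A_{ij} when i ≠
j. Since the form on `A` is pulled back along `π`, quasi-commutativity becomes the sign rule
(-1)^{jl} ba = (-1)^{ik} ab for a in A_{ij}, b in A_{kl} (`IsQuantumGroupExtension.mul_comm_sign`).

Take B to be the transmutation of `A`: the same coalgebra, graded by the parity i + j of the adjoint
coaction, with product (-1)^{j(k+l)} ab and antipode (-1)^{i(i+j)} S. The twist turns the sign rule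
into supercommutativity, and every braided Hopf axiom becomes the corresponding axiom of `A`
together with an identity between signs. The map σ is `π` itself.

The embedding a ↦ a₁ ⊗ π(a₂) sends a in A_{ij} to a ⊗ gʲ, and the cross relations of the
bosonization undo the twist, so it is a Hopf algebra map. Under σ ⊗ id its image goes to Δ(π(a)),
which gives the spin-statistics condition. Conversely, for a ⊗ gᵖ with p ≠ j the middle leg is
supported on gᵐ ⊗ gⁿ with m ≠ n. A functional vanishing on the diagonal detects this
(`Transmutation.offDiag_bosComul`), so no larger subspace satisfies the condition. -/

/-- The sign `(-1)^(i j)`, as an integer. -/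
def sgn (i j : ZMod 2) : ℤ := (-1) ^ (i.val * j.val)

/-! ### The group-like basis of C(ℤ₂) and its coefficient functionals. -/

/-- The group-like element `gⁱ` of `C(ℤ₂)`. -/
noncomputable def gl (i : ZMod 2) : CZ2 := AddMonoidAlgebra.single i 1

theorem superR_gl (i j : ZMod 2) : superR (gl i) (gl j) = (sgn i j : ℂ) := by
  simp [superR_single, sgn, gl]

theorem gl_mul (i j : ZMod 2) : gl i * gl j = gl (i + j) := by
  simp [gl, AddMonoidAlgebra.single_mul_single]

theorem gl_zero : gl 0 = 1 := rfl

@[simp] theorem comul_gl (i : ZMod 2) : Coalgebra.comul (R := ℂ) (gl i) = gl i ⊗ₜ[ℂ] gl i := by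
  simp [gl]

@[simp] theorem counit_gl (i : ZMod 2) : Coalgebra.counit (R := ℂ) (gl i) = 1 := by
  simp [gl]

@[simp] theorem antipode_gl (i : ZMod 2) : HopfAlgebra.antipode ℂ (gl i) = gl i := by
  simp [gl]

/-- The coefficient of `gⁱ`. -/
noncomputable def coeffL (i : ZMod 2) : CZ2 →ₗ[ℂ] ℂ :=
  Finsupp.lapply i ∘ₗ (AddMonoidAlgebra.coeffLinearEquiv ℂ).toLinearMap

theorem coeffL_gl (i j : ZMod 2) : coeffL i (gl j) = if j = i then 1 else 0 := by
  simp [coeffL, gl, AddMonoidAlgebra.coeffLinearEquiv, Finsupp.single_apply]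

theorem CZ2_ext {M : Type*} [AddCommGroup M] [Module ℂ M] {f g : CZ2 →ₗ[ℂ] M}
    (h : ∀ i, f (gl i) = g (gl i)) : f = g := by
  ext i
  simpa [gl] using h i

/-! ### Functionals acting on a coalgebra from either side. -/

section Action

variable {C : Type*} [AddCommGroup C] [Module ℂ C] [Coalgebra ℂ C]

/-- The action `c ↦ f(c₁) c₂` of a functional `f` on a coalgebra. -/
noncomputable def actL (f : C →ₗ[ℂ] ℂ) : C →ₗ[ℂ] C :=
  (TensorProduct.lid ℂ C).toLinearMap ∘ₗ TensorProduct.map f LinearMap.id ∘ₗ Coalgebra.comul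

/-- The action `c ↦ c₁ f(c₂)` of a functional `f` on a coalgebra. -/
noncomputable def actR (f : C →ₗ[ℂ] ℂ) : C →ₗ[ℂ] C :=
  (TensorProduct.rid ℂ C).toLinearMap ∘ₗ TensorProduct.map LinearMap.id f ∘ₗ Coalgebra.comul

/-- By coassociativity, a functional evaluated on the outermost leg leaves the other legs free to be
split. -/
theorem comul_actL (f : C →ₗ[ℂ] ℂ) (c : C) : Coalgebra.comul (R := ℂ) (actL f c) =
    TensorProduct.map (actL f) LinearMap.id (Coalgebra.comul (R := ℂ) c) := by
  have h1 : Coalgebra.comul ∘ₗ (TensorProduct.lid ℂ C).toLinearMap ∘ₗ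
      TensorProduct.map f LinearMap.id =
      (TensorProduct.lid ℂ (C ⊗[ℂ] C)).toLinearMap ∘ₗ TensorProduct.map f LinearMap.id ∘ₗ
        LinearMap.lTensor C Coalgebra.comul := by
    ext; simp
  have h2 : (TensorProduct.lid ℂ (C ⊗[ℂ] C)).toLinearMap ∘ₗ TensorProduct.map f LinearMap.id ∘ₗ
      (TensorProduct.assoc ℂ C C C).toLinearMap =
      TensorProduct.map ((TensorProduct.lid ℂ C).toLinearMap ∘ₗ
        TensorProduct.map f LinearMap.id) LinearMap.id := by
    ext; simp [TensorProduct.smul_tmul']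
  have h := LinearMap.congr_fun h1 (Coalgebra.comul (R := ℂ) c)
  simp only [LinearMap.comp_apply] at h
  rw [← Coalgebra.coassoc_apply] at h
  refine h.trans ((LinearMap.congr_fun h2 _).trans ?_)
  simp only [actL, LinearMap.rTensor, TensorProduct.map_map, LinearMap.comp_assoc,
    LinearMap.id_comp]

theorem comul_actR (f : C →ₗ[ℂ] ℂ) (c : C) : Coalgebra.comul (R := ℂ) (actR f c) =
    TensorProduct.map LinearMap.id (actR f) (Coalgebra.comul (R := ℂ) c) := by
  have h1 : Coalgebra.comul ∘ₗ (TensorProduct.rid ℂ C).toLinearMap ∘ₗ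
      TensorProduct.map LinearMap.id f =
      (TensorProduct.rid ℂ (C ⊗[ℂ] C)).toLinearMap ∘ₗ TensorProduct.map LinearMap.id f ∘ₗ
        LinearMap.rTensor C Coalgebra.comul := by
    ext; simp
  have h2 : (TensorProduct.rid ℂ (C ⊗[ℂ] C)).toLinearMap ∘ₗ TensorProduct.map LinearMap.id f ∘ₗ
      (TensorProduct.assoc ℂ C C C).symm.toLinearMap =
      TensorProduct.map LinearMap.id ((TensorProduct.rid ℂ C).toLinearMap ∘ₗ
        TensorProduct.map LinearMap.id f) := by
    ext; simp
  have h := LinearMap.congr_fun h1 (Coalgebra.comul (R := ℂ) c)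
  simp only [LinearMap.comp_apply] at h
  rw [← Coalgebra.coassoc_symm_apply] at h
  refine h.trans ((LinearMap.congr_fun h2 _).trans ?_)
  simp only [actR, LinearMap.lTensor, TensorProduct.map_map, LinearMap.comp_assoc,
    LinearMap.id_comp]

/-- Both sides are c₁ f(c₂) ⊗ c₃. This carries a degree projection across the tensor sign in Δ c. -/
theorem map_actR_comul (f : C →ₗ[ℂ] ℂ) (c : C) :
    TensorProduct.map (actR f) LinearMap.id (Coalgebra.comul (R := ℂ) c) =
    TensorProduct.map LinearMap.id (actL f) (Coalgebra.comul (R := ℂ) c) := by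
  have h : TensorProduct.map ((TensorProduct.rid ℂ C).toLinearMap ∘ₗ
        TensorProduct.map LinearMap.id f) LinearMap.id =
      TensorProduct.map LinearMap.id ((TensorProduct.lid ℂ C).toLinearMap ∘ₗ
        TensorProduct.map f LinearMap.id) ∘ₗ (TensorProduct.assoc ℂ C C C).toLinearMap := by
    ext; simp [TensorProduct.smul_tmul]
  have h' := LinearMap.congr_fun h
    (LinearMap.rTensor C Coalgebra.comul (Coalgebra.comul (R := ℂ) c))
  simp only [LinearMap.comp_apply, LinearEquiv.coe_coe, Coalgebra.coassoc_apply] at h'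
  simp only [LinearMap.rTensor, LinearMap.lTensor, TensorProduct.map_map, LinearMap.comp_assoc,
    LinearMap.id_comp] at h'
  exact h'

theorem actL_counit : actL (Coalgebra.counit : C →ₗ[ℂ] ℂ) = LinearMap.id := by
  ext c
  simpa [actL, LinearMap.rTensor] using
    congrArg (TensorProduct.lid ℂ C) (Coalgebra.rTensor_counit_comul (R := ℂ) c)

theorem actR_counit : actR (Coalgebra.counit : C →ₗ[ℂ] ℂ) = LinearMap.id := by
  ext c
  simpa [actR, LinearMap.lTensor] using
    congrArg (TensorProduct.rid ℂ C) (Coalgebra.lTensor_counit_comul (R := ℂ) c)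

theorem actL_add (f g : C →ₗ[ℂ] ℂ) : actL (f + g) = actL f + actL g := by
  ext; simp [actL, TensorProduct.map_add_left]

theorem actR_add (f g : C →ₗ[ℂ] ℂ) : actR (f + g) = actR f + actR g := by
  ext; simp [actR, TensorProduct.map_add_right]

theorem map_actL_comp {D : Type*} [AddCommGroup D] [Module ℂ D] [Coalgebra ℂ D]
    (p : C →ₗc[ℂ] D) (f : D →ₗ[ℂ] ℂ) (c : C) :
    p (actL (f ∘ₗ p) c) = actL f (p c) := by
  have h : (p : C →ₗ[ℂ] D) ∘ₗ (TensorProduct.lid ℂ C).toLinearMap ∘ₗ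
      TensorProduct.map (f ∘ₗ p) LinearMap.id =
      (TensorProduct.lid ℂ D).toLinearMap ∘ₗ TensorProduct.map f LinearMap.id ∘ₗ
      TensorProduct.map (p : C →ₗ[ℂ] D) (p : C →ₗ[ℂ] D) := by
    ext; simp
  have := LinearMap.congr_fun h (Coalgebra.comul (R := ℂ) c)
  simp only [LinearMap.comp_apply, CoalgHomClass.map_comp_comul_apply] at this
  exact this

theorem map_actR_comp {D : Type*} [AddCommGroup D] [Module ℂ D] [Coalgebra ℂ D]
    (p : C →ₗc[ℂ] D) (f : D →ₗ[ℂ] ℂ) (c : C) :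
    p (actR (f ∘ₗ p) c) = actR f (p c) := by
  have h : (p : C →ₗ[ℂ] D) ∘ₗ (TensorProduct.rid ℂ C).toLinearMap ∘ₗ
      TensorProduct.map LinearMap.id (f ∘ₗ p) =
      (TensorProduct.rid ℂ D).toLinearMap ∘ₗ TensorProduct.map LinearMap.id f ∘ₗ
      TensorProduct.map (p : C →ₗ[ℂ] D) (p : C →ₗ[ℂ] D) := by
    ext; simp
  have := LinearMap.congr_fun h (Coalgebra.comul (R := ℂ) c)
  simp only [LinearMap.comp_apply, CoalgHomClass.map_comp_comul_apply] at this
  exact this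

end Action

/-- Since gᵏ is group-like, a functional acts on it by the scalar f(gᵏ). -/
theorem actL_coeffL (i : ZMod 2) (h : CZ2) : actL (coeffL i) h = coeffL i h • gl i := by
  revert h
  refine LinearMap.congr_fun (g := (coeffL i).smulRight (gl i)) (CZ2_ext fun k => ?_)
  by_cases hk : k = i <;> simp [actL, coeffL_gl, hk]

theorem actR_coeffL (i : ZMod 2) (h : CZ2) : actR (coeffL i) h = coeffL i h • gl i := by
  revert h
  refine LinearMap.congr_fun (g := (coeffL i).smulRight (gl i)) (CZ2_ext fun k => ?_)
  by_cases hk : k = i <;> simp [actR, coeffL_gl, hk]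

/-- A partition of the counit: it makes the degree projections of any comodule add up to the
identity. -/
theorem coeffL_add : coeffL 0 + coeffL 1 = Coalgebra.counit := by
  refine CZ2_ext fun k => ?_
  have h : ∀ k : ZMod 2, k = 0 ∨ k = 1 := by decide
  obtain rfl | rfl := h k <;> simp [coeffL_gl]

/-! ### The bigrading of A induced by π. -/

variable {A : Type u} [Ring A] [HopfAlgebra ℂ A] (π : A →ₐc[ℂ] CZ2)

/-- The left coaction `a ↦ π(a₁) ⊗ a₂`. -/
noncomputable def coactL : A →ₐ[ℂ] CZ2 ⊗[ℂ] A :=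
  (Algebra.TensorProduct.map (π : A →ₐ[ℂ] CZ2) (AlgHom.id ℂ A)).comp (Bialgebra.comulAlgHom ℂ A)

/-- The right coaction `a ↦ a₁ ⊗ π(a₂)`. -/
noncomputable def coactR : A →ₐ[ℂ] A ⊗[ℂ] CZ2 :=
  (Algebra.TensorProduct.map (AlgHom.id ℂ A) (π : A →ₐ[ℂ] CZ2)).comp (Bialgebra.comulAlgHom ℂ A)

/-- The projection to the part with `π(a₁) ⊗ a₂ = gⁱ ⊗ a`. -/
noncomputable def projL (i : ZMod 2) : A →ₗ[ℂ] A :=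
  actL (coeffL i ∘ₗ ((π : A →ₗc[ℂ] CZ2) : A →ₗ[ℂ] CZ2))

/-- The projection to the part with `a₁ ⊗ π(a₂) = a ⊗ gʲ`. -/
noncomputable def projR (j : ZMod 2) : A →ₗ[ℂ] A :=
  actR (coeffL j ∘ₗ ((π : A →ₗc[ℂ] CZ2) : A →ₗ[ℂ] CZ2))

/-- The elements `a` with `π(a₁) ⊗ a₂ = gⁱ ⊗ a` and `a₁ ⊗ π(a₂) = a ⊗ gʲ`. -/
noncomputable def bideg (i j : ZMod 2) : Submodule ℂ A :=
  LinearMap.eqLocus (coactL π).toLinearMap (TensorProduct.mk ℂ CZ2 A (gl i)) ⊓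
  LinearMap.eqLocus (coactR π).toLinearMap ((TensorProduct.mk ℂ A CZ2).flip (gl j))

variable {π}

theorem mem_bideg {i j : ZMod 2} {a : A} :
    a ∈ bideg π i j ↔ coactL π a = gl i ⊗ₜ a ∧ coactR π a = a ⊗ₜ gl j := Iff.rfl

theorem bideg_mul {i j k l : ZMod 2} {a b : A} (ha : a ∈ bideg π i j) (hb : b ∈ bideg π k l) :
    a * b ∈ bideg π (i + k) (j + l) := by
  rw [mem_bideg] at *
  simp [ha, hb, gl_mul]

theorem bideg_one : (1 : A) ∈ bideg π 0 0 := by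
  rw [mem_bideg]
  simp [gl_zero, Algebra.TensorProduct.one_def]

theorem coactL_apply {a : A} {ι : Type*} {s : Finset ι} {x y : ι → A}
    (h : Coalgebra.comul (R := ℂ) a = ∑ t ∈ s, x t ⊗ₜ[ℂ] y t) :
    coactL π a = ∑ t ∈ s, π (x t) ⊗ₜ y t := by
  simp [coactL, h, map_sum]

theorem coactR_apply {a : A} {ι : Type*} {s : Finset ι} {x y : ι → A}
    (h : Coalgebra.comul (R := ℂ) a = ∑ t ∈ s, x t ⊗ₜ[ℂ] y t) :
    coactR π a = ∑ t ∈ s, x t ⊗ₜ π (y t) := by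
  simp [coactR, h, map_sum]

/-- Apply id ⊗ ε to π(a₁) ⊗ a₂ = gⁱ ⊗ a. -/
theorem map_of_mem_left {i j : ZMod 2} {a : A} (ha : a ∈ bideg π i j) :
    π a = Coalgebra.counit (R := ℂ) a • gl i := by
  have h := congrArg ((TensorProduct.rid ℂ CZ2).toLinearMap ∘ₗ
    TensorProduct.map LinearMap.id Coalgebra.counit) (mem_bideg.1 ha).1
  obtain ⟨s, hs⟩ := TensorProduct.exists_finset (Coalgebra.comul (R := ℂ) a)
  rw [coactL_apply hs] at h
  have h2 := congrArg ((TensorProduct.rid ℂ A).toLinearMap)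
    (Coalgebra.lTensor_counit_comul (R := ℂ) a)
  rw [hs] at h2
  simp at h h2
  rw [← h]
  conv_lhs => rw [← h2]
  simp

theorem map_of_mem_right {i j : ZMod 2} {a : A} (ha : a ∈ bideg π i j) :
    π a = Coalgebra.counit (R := ℂ) a • gl j := by
  have h := congrArg ((TensorProduct.lid ℂ CZ2).toLinearMap ∘ₗ
    TensorProduct.map Coalgebra.counit LinearMap.id) (mem_bideg.1 ha).2
  obtain ⟨s, hs⟩ := TensorProduct.exists_finset (Coalgebra.comul (R := ℂ) a)
  rw [coactR_apply hs] at h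
  have h2 := congrArg ((TensorProduct.lid ℂ A).toLinearMap)
    (Coalgebra.rTensor_counit_comul (R := ℂ) a)
  rw [hs] at h2
  simp at h h2
  rw [← h]
  conv_lhs => rw [← h2]
  simp

/-- π(a) equals both ε(a) gⁱ and ε(a) gʲ. This disposes of the off-diagonal bidegrees, where the
signs in the counit, antipode and σ axioms need not agree. -/
theorem counit_eq_zero_of_mem {i j : ZMod 2} (hij : i ≠ j) {a : A} (ha : a ∈ bideg π i j) :
    Coalgebra.counit (R := ℂ) a = 0 := by
  have h := congrArg (coeffL i) ((map_of_mem_left ha).symm.trans (map_of_mem_right ha))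
  simpa [coeffL_gl, hij.symm] using h

theorem projL_add (a : A) : projL π 0 a + projL π 1 a = a := by
  rw [projL, projL, ← LinearMap.add_apply, ← actL_add, ← LinearMap.add_comp, coeffL_add,
    CoalgHomClass.counit_comp, actL_counit, LinearMap.id_apply]

theorem projR_add (a : A) : projR π 0 a + projR π 1 a = a := by
  rw [projR, projR, ← LinearMap.add_apply, ← actR_add, ← LinearMap.add_comp, coeffL_add,
    CoalgHomClass.counit_comp, actR_counit, LinearMap.id_apply]

theorem coactL_eq (a : A) : coactL π a =
    TensorProduct.map ((π : A →ₗc[ℂ] CZ2) : A →ₗ[ℂ] CZ2) LinearMap.id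
      (Coalgebra.comul (R := ℂ) a) :=
  rfl

theorem coactR_eq (a : A) : coactR π a =
    TensorProduct.map LinearMap.id ((π : A →ₗc[ℂ] CZ2) : A →ₗ[ℂ] CZ2)
      (Coalgebra.comul (R := ℂ) a) :=
  rfl

theorem projL_eq (i : ZMod 2) (a : A) : projL π i a =
    TensorProduct.lid ℂ A (TensorProduct.map (coeffL i) LinearMap.id (coactL π a)) := by
  rw [coactL_eq, ← LinearMap.comp_apply (TensorProduct.map _ _), ← TensorProduct.map_comp]
  rfl

theorem projR_eq (i : ZMod 2) (a : A) : projR π i a =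
    TensorProduct.rid ℂ A (TensorProduct.map LinearMap.id (coeffL i) (coactR π a)) := by
  rw [coactR_eq, ← LinearMap.comp_apply (TensorProduct.map _ _), ← TensorProduct.map_comp]
  rfl

/-- `π` intertwines the actions, so π ∘ `projL π i` takes values in the line spanned by gⁱ. -/
theorem coactL_projL (i : ZMod 2) (a : A) : coactL π (projL π i a) = gl i ⊗ₜ projL π i a := by
  have h : ((π : A →ₗc[ℂ] CZ2) : A →ₗ[ℂ] CZ2) ∘ₗ projL π i =
      (coeffL i ∘ₗ ((π : A →ₗc[ℂ] CZ2) : A →ₗ[ℂ] CZ2)).smulRight (gl i) := by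
    ext1 a
    exact (map_actL_comp (π : A →ₗc[ℂ] CZ2) (coeffL i) a).trans (actL_coeffL _ _)
  rw [coactL_eq, projL, comul_actL, ← projL, ← LinearMap.comp_apply, ← TensorProduct.map_comp, h,
    projL, actL]
  simp only [LinearMap.comp_apply]
  induction Coalgebra.comul (R := ℂ) a with
  | zero => simp
  | add x y hx hy => simp_all [TensorProduct.tmul_add]
  | tmul x y => simp [TensorProduct.smul_tmul]

theorem coactR_projR (i : ZMod 2) (a : A) : coactR π (projR π i a) = projR π i a ⊗ₜ gl i := by
  have h : ((π : A →ₗc[ℂ] CZ2) : A →ₗ[ℂ] CZ2) ∘ₗ projR π i =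
      (coeffL i ∘ₗ ((π : A →ₗc[ℂ] CZ2) : A →ₗ[ℂ] CZ2)).smulRight (gl i) := by
    ext1 a
    exact (map_actR_comp (π : A →ₗc[ℂ] CZ2) (coeffL i) a).trans (actR_coeffL _ _)
  rw [coactR_eq, projR, comul_actR, ← projR, ← LinearMap.comp_apply, ← TensorProduct.map_comp, h,
    projR, actR]
  simp only [LinearMap.comp_apply]
  induction Coalgebra.comul (R := ℂ) a with
  | zero => simp
  | add x y hx hy => simp_all [TensorProduct.add_tmul]
  | tmul x y => simp [TensorProduct.smul_tmul]

/-- The left and right coactions commute, by coassociativity. -/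
theorem coactL_projR (j : ZMod 2) (a : A) :
    coactL π (projR π j a) = TensorProduct.map LinearMap.id (projR π j) (coactL π a) := by
  rw [coactL_eq, coactL_eq, projR, comul_actR]
  simp only [TensorProduct.map_map, LinearMap.id_comp, LinearMap.comp_id]

variable (π) in
/-- The projection to `bideg π i j`. -/
noncomputable def proj (i j : ZMod 2) : A →ₗ[ℂ] A := projR π j ∘ₗ projL π i

theorem proj_mem (i j : ZMod 2) (a : A) : proj π i j a ∈ bideg π i j := by
  rw [mem_bideg]
  refine ⟨?_, coactR_projR _ _⟩
  simp [proj, coactL_projR, coactL_projL]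

theorem sum_proj (a : A) : ∑ i, ∑ j, proj π i j a = a := by
  have h (b : A) : ∑ j, projR π j b = b := (Fin.sum_univ_two _).trans (projR_add b)
  simp only [proj, LinearMap.comp_apply, h]
  exact (Fin.sum_univ_two _).trans (projL_add a)

theorem projL_of_mem {i j : ZMod 2} {a : A} (ha : a ∈ bideg π i j) (k : ZMod 2) :
    projL π k a = if i = k then a else 0 := by
  rw [projL_eq, (mem_bideg.1 ha).1]
  simp [coeffL_gl]

theorem projR_of_mem {i j : ZMod 2} {a : A} (ha : a ∈ bideg π i j) (k : ZMod 2) :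
    projR π k a = if j = k then a else 0 := by
  rw [projR_eq, (mem_bideg.1 ha).2]
  simp [coeffL_gl]

theorem proj_of_mem {i j : ZMod 2} {a : A} (ha : a ∈ bideg π i j) (k l : ZMod 2) :
    proj π k l a = if i = k ∧ j = l then a else 0 := by
  rw [proj, LinearMap.comp_apply, projL_of_mem ha]
  by_cases h : i = k <;> simp [h, projR_of_mem ha]

/-- A linear map on `A` is determined by its values on homogeneous elements. -/
theorem linearMap_ext_bideg {M : Type*} [AddCommGroup M] [Module ℂ M] {f g : A →ₗ[ℂ] M}
    (h : ∀ i j, ∀ a ∈ bideg π i j, f a = g a) : f = g := by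
  ext a
  rw [← sum_proj (π := π) a]
  simp only [map_sum]
  exact Finset.sum_congr rfl fun i _ => Finset.sum_congr rfl fun j _ => h i j _ (proj_mem i j a)

/-- The matrix-coalgebra rule Δ A_{ij} ⊆ ⊕ₘ A_{im} ⊗ A_{mj}. The first entry of the index t is the
intermediate degree m; the memberships hold for every t, so they can be used for rewriting under
sums. -/
theorem exists_homogeneous_repr {i j : ZMod 2} {a : A} (ha : a ∈ bideg π i j) :
    ∃ (s : Finset (ZMod 2 × A × A)) (x y : ZMod 2 × A × A → A),
      (∀ t, x t ∈ bideg π i t.1) ∧ (∀ t, y t ∈ bideg π t.1 j) ∧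
      Coalgebra.comul (R := ℂ) a = ∑ t ∈ s, x t ⊗ₜ[ℂ] y t := by
  obtain ⟨s, hs⟩ := TensorProduct.exists_finset (Coalgebra.comul (R := ℂ) a)
  -- Each pure tensor u ⊗ v of an arbitrary expansion is replaced by its components proj i m u ⊗
  -- proj m j v, for both values of m.
  refine ⟨Finset.univ ×ˢ s, fun t => proj π i t.1 t.2.1, fun t => proj π t.1 j t.2.2,
    fun t => proj_mem _ _ _, fun t => proj_mem _ _ _, ?_⟩
  have h1 : a = projR π j (projL π i a) := by
    simp [projL_of_mem ha, projR_of_mem ha]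
  have h2 : Coalgebra.comul (R := ℂ) a =
      TensorProduct.map (projL π i) (projR π j) (Coalgebra.comul (R := ℂ) a) := by
    conv_lhs => rw [h1, projR, comul_actR, ← projR, projL, comul_actL, ← projL]
    simp only [TensorProduct.map_map, LinearMap.id_comp, LinearMap.comp_id]
  have h3 (m : ZMod 2) : projR π m ∘ₗ projR π m = projR π m := by
    ext a
    rw [LinearMap.comp_apply, projR_eq m (projR π m a), coactR_projR]
    simp [coeffL_gl]
  -- The right degree of the first leg must match the left degree of the second: split the identity
  -- on the first leg into idempotents and move one copy of each across the tensor sign by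
  -- `map_actR_comul`.
  have h4 : Coalgebra.comul (R := ℂ) a =
      ∑ m : ZMod 2, TensorProduct.map (projR π m) (projL π m) (Coalgebra.comul (R := ℂ) a) := by
    have h5 (m : ZMod 2) : TensorProduct.map (projR π m) (projL π m)
        (Coalgebra.comul (R := ℂ) a) =
        TensorProduct.map (projR π m) LinearMap.id (Coalgebra.comul (R := ℂ) a) := by
      conv_rhs => rw [← h3, ← LinearMap.id_comp LinearMap.id, TensorProduct.map_comp,
        LinearMap.comp_apply, projR, map_actR_comul, ← projL, ← projR]
      simp only [TensorProduct.map_map, LinearMap.id_comp, LinearMap.comp_id]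
    have h6 : projR π 0 + projR π 1 = LinearMap.id := LinearMap.ext projR_add
    simp only [h5]
    refine Eq.trans ?_ (Fin.sum_univ_two _).symm
    change _ = TensorProduct.map (projR π 0) LinearMap.id _ +
      TensorProduct.map (projR π 1) LinearMap.id _
    rw [← LinearMap.add_apply, ← TensorProduct.map_add_left, h6]
    simp
  have h7 (m : ZMod 2) : projL π i ∘ₗ projR π m = proj π i m := by
    ext a
    rw [proj, LinearMap.comp_apply, LinearMap.comp_apply, projL_eq, coactL_projR, projL_eq]
    induction coactL π a with
    | zero => simp
    | add x y hx hy => simp only [map_add, hx, hy]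
    | tmul x y => simp
  rw [h2, h4, map_sum, Finset.sum_product]
  refine Finset.sum_congr rfl fun m _ => ?_
  rw [TensorProduct.map_map, h7, hs, map_sum]
  rfl

variable (π) in
/-- The linear map that is given by `F i j` on `bideg π i j`. -/
noncomputable def homMap {M : Type*} [AddCommGroup M] [Module ℂ M]
    (F : ZMod 2 → ZMod 2 → A →ₗ[ℂ] M) : A →ₗ[ℂ] M :=
  ∑ i, ∑ j, F i j ∘ₗ proj π i j

theorem homMap_of_mem {M : Type*} [AddCommGroup M] [Module ℂ M]
    (F : ZMod 2 → ZMod 2 → A →ₗ[ℂ] M) {i j : ZMod 2} {a : A} (ha : a ∈ bideg π i j) :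
    homMap π F a = F i j a := by
  simp only [homMap, LinearMap.sum_apply, LinearMap.comp_apply, proj_of_mem ha]
  rw [Finset.sum_eq_single i, Finset.sum_eq_single j]
  · simp
  · intro l _ hl; simp [hl.symm]
  · simp
  · intro k _ hk; simp [hk.symm]
  · simp

/-! ### Counit and antipode identities for a chosen expansion of the coproduct. -/

theorem sum_counit_smul_right {a : A} {ι : Type*} {s : Finset ι} {x y : ι → A}
    (h : Coalgebra.comul (R := ℂ) a = ∑ t ∈ s, x t ⊗ₜ[ℂ] y t) :
    ∑ t ∈ s, Coalgebra.counit (R := ℂ) (x t) • y t = a := by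
  have h2 := congrArg ((TensorProduct.lid ℂ A).toLinearMap)
    (Coalgebra.rTensor_counit_comul (R := ℂ) a)
  simpa [h] using h2

theorem sum_counit_smul_left {a : A} {ι : Type*} {s : Finset ι} {x y : ι → A}
    (h : Coalgebra.comul (R := ℂ) a = ∑ t ∈ s, x t ⊗ₜ[ℂ] y t) :
    ∑ t ∈ s, Coalgebra.counit (R := ℂ) (y t) • x t = a := by
  have h2 := congrArg ((TensorProduct.rid ℂ A).toLinearMap)
    (Coalgebra.lTensor_counit_comul (R := ℂ) a)
  simpa [h] using h2

theorem sum_antipode_mul {a : A} {ι : Type*} {s : Finset ι} {x y : ι → A}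
    (h : Coalgebra.comul (R := ℂ) a = ∑ t ∈ s, x t ⊗ₜ[ℂ] y t) :
    ∑ t ∈ s, HopfAlgebra.antipode ℂ (x t) * y t = Coalgebra.counit (R := ℂ) a • (1 : A) := by
  have h2 := HopfAlgebra.mul_antipode_rTensor_comul_apply (R := ℂ) a
  rw [h] at h2
  simpa [Algebra.algebraMap_eq_smul_one] using h2

theorem sum_mul_antipode {a : A} {ι : Type*} {s : Finset ι} {x y : ι → A}
    (h : Coalgebra.comul (R := ℂ) a = ∑ t ∈ s, x t ⊗ₜ[ℂ] y t) :
    ∑ t ∈ s, x t * HopfAlgebra.antipode ℂ (y t) = Coalgebra.counit (R := ℂ) a • (1 : A) := by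
  have h2 := HopfAlgebra.mul_antipode_lTensor_comul_apply (R := ℂ) a
  rw [h] at h2
  simpa [Algebra.algebraMap_eq_smul_one] using h2

theorem add_self_zmod_two (i : ZMod 2) : i + i = 0 := CharTwo.add_self_eq_zero i

/-! ### The antipode exchanges left and right degree. -/

section Antipode

/-- An algebra map composed with the antipode is determined by being a convolution inverse. -/
theorem eq_comp_antipode {D : Type*} [Ring D] [Algebra ℂ D] (f : A →ₐ[ℂ] D) (g : A →ₗ[ℂ] D)
    (h : ∀ i j, ∀ a ∈ bideg π i j, LinearMap.mul' ℂ D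
      (TensorProduct.map g f.toLinearMap (Coalgebra.comul (R := ℂ) a)) =
        Coalgebra.counit (R := ℂ) a • (1 : D)) (a : A) : f (HopfAlgebra.antipode ℂ a) = g a := by
  have h1 : WithConv.toConv g * WithConv.toConv f.toLinearMap = 1 := by
    apply WithConv.ofConv_injective
    refine linearMap_ext_bideg (π := π) fun i j a ha => ?_
    exact (h i j a ha).trans (Algebra.algebraMap_eq_smul_one _).symm
  have h2 : WithConv.toConv f.toLinearMap *
      WithConv.toConv (f.toLinearMap ∘ₗ HopfAlgebra.antipode ℂ) = 1 := by
    have := LinearMap.algHom_comp_convMul_distrib f (WithConv.toConv (LinearMap.id : A →ₗ[ℂ] A))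
      (WithConv.toConv (HopfAlgebra.antipode ℂ))
    rw [LinearMap.id_mul_antipode] at this
    refine Eq.trans (congrArg WithConv.toConv this.symm) ?_
    apply WithConv.ofConv_injective
    ext a
    simp [LinearMap.convOne_def]
  have := left_inv_eq_right_inv h1 h2
  exact (LinearMap.congr_fun (WithConv.toConv_injective this) a).symm

/-- Each coaction is an algebra map, so its composite with S is its convolution inverse. The
expected formula for the coaction of S(a), defined degreewise, is also a left inverse, so the two
agree. -/
theorem antipode_mem {i j : ZMod 2} {a : A} (ha : a ∈ bideg π i j) :
    HopfAlgebra.antipode ℂ a ∈ bideg π j i := by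
  rw [mem_bideg]
  constructor
  · rw [eq_comp_antipode (π := π) (coactL π) (homMap π fun _ l =>
      TensorProduct.mk ℂ CZ2 A (gl l) ∘ₗ HopfAlgebra.antipode ℂ), homMap_of_mem _ ha]
    · rfl
    · intro i j a ha
      obtain ⟨s, x, y, hx, hy, h⟩ := exists_homogeneous_repr ha
      simp only [h, map_sum, TensorProduct.map_tmul, homMap_of_mem _ (hx _),
        AlgHom.toLinearMap_apply,
        (mem_bideg.1 (hy _)).1, LinearMap.mul'_apply, LinearMap.comp_apply,
        TensorProduct.mk_apply, Algebra.TensorProduct.tmul_mul_tmul, gl_mul, add_self_zmod_two]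
      rw [← TensorProduct.tmul_sum, sum_antipode_mul h, gl_zero, TensorProduct.tmul_smul]
      rfl
  · rw [eq_comp_antipode (π := π) (coactR π) (homMap π fun k _ =>
      (TensorProduct.mk ℂ A CZ2).flip (gl k) ∘ₗ HopfAlgebra.antipode ℂ), homMap_of_mem _ ha]
    · rfl
    · intro i j a ha
      by_cases hij : i = j
      · subst hij
        obtain ⟨s, x, y, hx, hy, h⟩ := exists_homogeneous_repr ha
        simp only [h, map_sum, TensorProduct.map_tmul, homMap_of_mem _ (hx _),
          AlgHom.toLinearMap_apply, (mem_bideg.1 (hy _)).2, LinearMap.mul'_apply,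
          LinearMap.comp_apply, LinearMap.flip_apply, TensorProduct.mk_apply,
          Algebra.TensorProduct.tmul_mul_tmul, gl_mul, add_self_zmod_two]
        rw [← TensorProduct.sum_tmul, sum_antipode_mul h, gl_zero, ← TensorProduct.smul_tmul']
        rfl
      -- Here the leftover factor is g^{i+j} ≠ 1, but it is multiplied by ε(a) = 0.
      · obtain ⟨s, x, y, hx, hy, h⟩ := exists_homogeneous_repr ha
        simp only [h, map_sum, TensorProduct.map_tmul, homMap_of_mem _ (hx _),
          AlgHom.toLinearMap_apply, (mem_bideg.1 (hy _)).2, LinearMap.mul'_apply,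
          LinearMap.comp_apply, LinearMap.flip_apply, TensorProduct.mk_apply,
          Algebra.TensorProduct.tmul_mul_tmul, gl_mul]
        rw [← TensorProduct.sum_tmul, sum_antipode_mul h, counit_eq_zero_of_mem hij ha]
        simp

end Antipode

/-! ### The commutation rule in A. -/

/-- The sign rule for the product of homogeneous elements. -/
theorem IsQuantumGroupExtension.mul_comm_sign {RA : A →ₗ[ℂ] A →ₗ[ℂ] ℂ}
    (hπ : IsQuantumGroupExtension superR RA π) {i j k l : ZMod 2} {a b : A}
    (ha : a ∈ bideg π i j) (hb : b ∈ bideg π k l) :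
    (sgn j l : ℂ) • (b * a) = (sgn i k : ℂ) • (a * b) := by
  have h := LinearMap.congr_fun hπ.coquasitriangular.quasi_comm (a ⊗ₜ b)
  obtain ⟨s, x, y, hx, hy, hs⟩ := exists_homogeneous_repr ha
  obtain ⟨s', x', y', hx', hy', hs'⟩ := exists_homogeneous_repr hb
  -- The form sees only `π` of its arguments, which is ε times a group-like: right degrees j, l on
  -- the y-legs, left degrees i, k on the x-legs. The sign is then constant over the sum, and the
  -- remaining counits collapse each coproduct.
  simp only [LinearMap.comp_apply, TensorProduct.comul_tmul, hs, hs', TensorProduct.sum_tmul,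
    TensorProduct.tmul_sum, map_sum, TensorProduct.AlgebraTensorModule.tensorTensorTensorComm_tmul,
    TensorProduct.map_tmul, LinearEquiv.coe_coe, TensorProduct.rid_tmul, TensorProduct.lid_tmul,
    TensorProduct.lift.tmul, LinearMap.mul'_apply, TensorProduct.comm_tmul, hπ.map_R,
    map_of_mem_left (hx _), map_of_mem_left (hx' _), map_of_mem_right (hy _),
    map_of_mem_right (hy' _), map_smul, LinearMap.smul_apply, superR_gl] at h
  have e1 : (sgn j l : ℂ) • (b * a) = ∑ u ∈ s', ∑ t ∈ s, (Coalgebra.counit (R := ℂ) (y' u) •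
      Coalgebra.counit (R := ℂ) (y t) • (sgn j l : ℂ)) • (x' u * x t) := by
    rw [← sum_counit_smul_left hs, ← sum_counit_smul_left hs']
    simp only [Finset.sum_mul, Finset.mul_sum, Finset.smul_sum, smul_mul_assoc, mul_smul_comm]
    rw [Finset.sum_comm]
    refine Finset.sum_congr rfl fun _ _ => Finset.sum_congr rfl fun _ _ => ?_
    simp only [smul_smul, smul_eq_mul]
    congr 1; ring
  have e2 : (sgn i k : ℂ) • (a * b) = ∑ u ∈ s', ∑ t ∈ s, (Coalgebra.counit (R := ℂ) (x' u) •
      Coalgebra.counit (R := ℂ) (x t) • (sgn i k : ℂ)) • (y t * y' u) := by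
    rw [← sum_counit_smul_right hs, ← sum_counit_smul_right hs']
    simp only [Finset.sum_mul, Finset.mul_sum, Finset.smul_sum, smul_mul_assoc, mul_smul_comm]
    refine Finset.sum_congr rfl fun _ _ => Finset.sum_congr rfl fun _ _ => ?_
    simp only [smul_smul, smul_eq_mul]
    congr 1; ring
  rw [e1, e2]
  simpa only [smul_eq_mul] using h

/-! ### The twisted product. -/

variable (π) in
/-- The product `(-1)^(j (k + l)) a b` of `a` in `bideg π i j` and `b` in `bideg π k l`. -/
noncomputable def twistedMul : A →ₗ[ℂ] A →ₗ[ℂ] A :=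
  homMap π fun _ j => (LinearMap.mul ℂ A).compl₂
    (homMap π fun k l => (sgn j (k + l) : ℂ) • LinearMap.id)

theorem twistedMul_of_mem {i j k l : ZMod 2} {a b : A}
    (ha : a ∈ bideg π i j) (hb : b ∈ bideg π k l) :
    twistedMul π a b = (sgn j (k + l) : ℂ) • (a * b) := by
  simp [twistedMul, homMap_of_mem _ ha, homMap_of_mem _ hb]

theorem sgn_zero_left (i : ZMod 2) : sgn 0 i = 1 := by revert i; decide

theorem sgn_zero_right (i : ZMod 2) : sgn i 0 = 1 := by revert i; decide

theorem twistedMul_one_left (b : A) : twistedMul π 1 b = b := by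
  revert b
  refine LinearMap.congr_fun (g := LinearMap.id) (linearMap_ext_bideg (π := π) fun i j b hb => ?_)
  simp [twistedMul_of_mem bideg_one hb, sgn_zero_left]

theorem twistedMul_one_right (a : A) : twistedMul π a 1 = a := by
  revert a
  refine LinearMap.congr_fun (f := (twistedMul π).flip 1) (g := LinearMap.id)
    (linearMap_ext_bideg (π := π) fun i j a ha => ?_)
  simp [twistedMul_of_mem ha bideg_one, sgn_zero_right]

theorem induction_bideg {p : A → Prop} (a : A) (add : ∀ a b, p a → p b → p (a + b))
    (hom : ∀ i j, ∀ a ∈ bideg π i j, p a) : p a := by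
  rw [← sum_proj (π := π) a]
  refine Finset.sum_induction _ p add (hom 0 0 0 (zero_mem _)) fun i _ =>
    Finset.sum_induction _ p add (hom 0 0 0 (zero_mem _)) fun j _ => hom i j _ (proj_mem i j a)

/-- The exponent j(k + l) is bilinear in the two bidegrees, so the sign is a 2-cocycle. -/
theorem twistedMul_assoc (a b c : A) :
    twistedMul π (twistedMul π a b) c = twistedMul π a (twistedMul π b c) := by
  induction a using induction_bideg (π := π) with
  | add a a' h h' => simp [h, h']
  | hom i j a ha =>
  induction b using induction_bideg (π := π) with
  | add a a' h h' => simp [h, h']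
  | hom k l b hb =>
  induction c using induction_bideg (π := π) with
  | add a a' h h' => simp [h, h']
  | hom m n c hc =>
  simp only [twistedMul_of_mem ha hb, twistedMul_of_mem hb hc, map_smul, LinearMap.smul_apply,
    twistedMul_of_mem (bideg_mul ha hb) hc, twistedMul_of_mem ha (bideg_mul hb hc), smul_smul,
    mul_assoc]
  congr 1
  -- Integer-valued signs make the parity identity a finite check, transferred to ℂ by casting.
  have : ∀ j k l m n : ZMod 2, sgn j (k + l) * sgn (j + l) (m + n) =
    sgn l (m + n) * sgn j (k + m + (l + n)) := by decide
  exact_mod_cast this j k l m n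

/-! ### The transmutation of A and its structure maps. -/

variable (π) in
/-- The Hopf algebra `A` with the product `twistedMul π`. -/
def Transmutation : Type u :=
  -- A phantom dependence on `π`, so that the structures depending on `π` can be attached to this
  -- type without clashing with those of A.
  let _ := π
  A

namespace Transmutation

noncomputable instance instAddCommGroup : AddCommGroup (Transmutation π) :=
  inferInstanceAs (AddCommGroup A)

noncomputable instance instModule : Module ℂ (Transmutation π) := inferInstanceAs (Module ℂ A)

variable (π) in
/-- The product of `Transmutation π`, as a bilinear map. -/
noncomputable def mulMap :
    Transmutation π →ₗ[ℂ] Transmutation π →ₗ[ℂ] Transmutation π :=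
  twistedMul (A := A) π

noncomputable instance instMul : Mul (Transmutation π) := ⟨fun a b => mulMap π a b⟩

noncomputable instance instOne : One (Transmutation π) := ⟨(1 : A)⟩

noncomputable instance instRing : Ring (Transmutation π) :=
  { instAddCommGroup (π := π), instMul (π := π), instOne (π := π) with
    mul_assoc := twistedMul_assoc (π := π)
    one_mul := twistedMul_one_left (π := π)
    mul_one := twistedMul_one_right (π := π)
    left_distrib := fun a b c => map_add (mulMap π a) b c
    right_distrib := fun a b c => LinearMap.map_add₂ (mulMap π) a b c
    zero_mul := fun a => LinearMap.map_zero₂ (mulMap π) a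
    mul_zero := fun a => map_zero (mulMap π a) }

noncomputable instance instAlgebra : Algebra ℂ (Transmutation π) :=
  Algebra.ofModule (fun r a b => LinearMap.map_smul₂ (mulMap π) r a b)
    (fun r a b => map_smul (mulMap π a) r b)

variable (π) in
/-- The identity map `A → Transmutation π`. -/
noncomputable def of : A ≃ₗ[ℂ] Transmutation π := LinearEquiv.refl ℂ A

noncomputable instance instCoalgebra : Coalgebra ℂ (Transmutation π) :=
  inferInstanceAs (Coalgebra ℂ A)

theorem of_one : of π 1 = 1 := rfl

theorem of_mul_of (a b : A) : of π a * of π b = of π (twistedMul π a b) := rfl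

theorem counit_of (a : A) :
    Coalgebra.counit (R := ℂ) (of π a) = Coalgebra.counit (R := ℂ) a := rfl

theorem comul_of (a : A) : Coalgebra.comul (R := ℂ) (of π a) =
    TensorProduct.map (of π).toLinearMap (of π).toLinearMap
      (Coalgebra.comul (R := ℂ) a) :=
  (LinearMap.congr_fun TensorProduct.map_id _).symm

theorem of_mul_of_mem {i j k l : ZMod 2} {a b : A}
    (ha : a ∈ bideg π i j) (hb : b ∈ bideg π k l) :
    of π a * of π b = (sgn j (k + l) : ℂ) • of π (a * b) := by
  rw [of_mul_of, twistedMul_of_mem ha hb, map_smul]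

theorem comul_of_eq_sum {a : A} {ι : Type*} {s : Finset ι} {x y : ι → A}
    (h : Coalgebra.comul (R := ℂ) a = ∑ t ∈ s, x t ⊗ₜ[ℂ] y t) :
    Coalgebra.comul (R := ℂ) (of π a) = ∑ t ∈ s, of π (x t) ⊗ₜ[ℂ] of π (y t) := by
  simp [comul_of, h, map_sum]

variable (π) in
/-- The coaction `a ↦ gⁱ⁺ʲ ⊗ a` on `bideg π i j`. -/
noncomputable def coact : Transmutation π →ₗ[ℂ] CZ2 ⊗[ℂ] Transmutation π :=
  (homMap π fun i j => TensorProduct.mk ℂ CZ2 (Transmutation π) (gl (i + j)) ∘ₗ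
    (of π).toLinearMap) ∘ₗ (of π).symm.toLinearMap

theorem coact_of {i j : ZMod 2} {a : A} (ha : a ∈ bideg π i j) :
    coact π (of π a) = gl (i + j) ⊗ₜ of π a := by
  simp [coact, homMap_of_mem _ ha]

variable (π) in
/-- The antipode `a ↦ (-1)^(i (i + j)) S(a)` on `bideg π i j`. -/
noncomputable def antipode : Transmutation π →ₗ[ℂ] Transmutation π :=
  (homMap π fun i j => (sgn i (i + j) : ℂ) • ((of π).toLinearMap ∘ₗ HopfAlgebra.antipode ℂ)) ∘ₗ
    (of π).symm.toLinearMap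

theorem antipode_of {i j : ZMod 2} {a : A} (ha : a ∈ bideg π i j) :
    antipode π (of π a) = (sgn i (i + j) : ℂ) • of π (HopfAlgebra.antipode ℂ a) := by
  simp [antipode, homMap_of_mem _ ha]

variable (π) in
/-- The map `π`, on the transmutation. -/
noncomputable def proj : Transmutation π →ₗ[ℂ] CZ2 :=
  ((π : A →ₗc[ℂ] CZ2) : A →ₗ[ℂ] CZ2) ∘ₗ (of π).symm.toLinearMap

theorem proj_of (a : A) : proj π (of π a) = π a := by
  simp [proj]

theorem linearMap_ext {M : Type*} [AddCommGroup M] [Module ℂ M] {f g : Transmutation π →ₗ[ℂ] M}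
    (h : ∀ i j, ∀ a ∈ bideg π i j, f (of π a) = g (of π a)) : f = g := by
  have := linearMap_ext_bideg (π := π) (f := f ∘ₗ (of π).toLinearMap)
    (g := g ∘ₗ (of π).toLinearMap) h
  ext a
  exact LinearMap.congr_fun this a

theorem linearMap_ext₂ {M : Type*} [AddCommGroup M] [Module ℂ M]
    {f g : Transmutation π ⊗[ℂ] Transmutation π →ₗ[ℂ] M}
    (h : ∀ i j k l, ∀ a ∈ bideg π i j, ∀ b ∈ bideg π k l,
      f (of π a ⊗ₜ of π b) = g (of π a ⊗ₜ of π b)) : f = g := by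
  refine TensorProduct.ext (linearMap_ext fun i j a ha => linearMap_ext fun k l b hb => ?_)
  exact h i j k l a ha b hb

/-! ### The transmutation as a supercommutative super Hopf algebra over C(ℤ₂). -/

theorem braiding_of {i j k l : ZMod 2} {a b : A}
    (ha : a ∈ bideg π i j) (hb : b ∈ bideg π k l) :
    braiding superR (coact π) (coact π) (of π a ⊗ₜ of π b) =
      (sgn (i + j) (k + l) : ℂ) • (of π b ⊗ₜ of π a) := by
  have : sgn (k + l) (i + j) = sgn (i + j) (k + l) := by simp [sgn, mul_comm]
  simp [braiding, coact_of ha, coact_of hb, superR_gl, this]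

theorem tensorCoaction_of {i j k l : ZMod 2} {a b : A}
    (ha : a ∈ bideg π i j) (hb : b ∈ bideg π k l) :
    tensorCoaction (coact π) (coact π) (of π a ⊗ₜ of π b) =
      gl (i + j + (k + l)) ⊗ₜ (of π a ⊗ₜ of π b) := by
  simp [tensorCoaction, coact_of ha, coact_of hb, gl_mul]

theorem isLeftCoaction_coact : IsLeftCoaction (coact π) where
  coassoc := linearMap_ext fun i j a ha => by simp [coact_of ha]
  counit := linearMap_ext fun i j a ha => by simp [coact_of ha]

theorem isBraidedCommutative {RA : A →ₗ[ℂ] A →ₗ[ℂ] ℂ}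
    (hπ : IsQuantumGroupExtension superR RA π) : IsBraidedCommutative superR (coact π) := by
  refine linearMap_ext₂ fun i j k l a ha b hb => ?_
  have h := hπ.mul_comm_sign ha hb
  simp only [LinearMap.comp_apply, braiding_of ha hb, LinearMap.mul'_apply, map_smul,
    of_mul_of_mem ha hb, of_mul_of_mem hb ha]
  -- The commutation rule of A, solved for ba using that signs square to 1.
  have h2 : of π (b * a) = ((sgn j l * sgn i k : ℤ) : ℂ) • of π (a * b) := by
    have : (sgn j l : ℂ) * sgn j l = 1 := by
      exact_mod_cast (by decide : ∀ j l, sgn j l * sgn j l = 1) j l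
    rw [← map_smul, Int.cast_mul, mul_smul, ← h, smul_smul, this, one_smul]
  rw [h2, smul_smul, smul_smul]
  congr 1
  exact_mod_cast (by decide : ∀ i j k l, sgn j (k + l) =
    sgn (i + j) (k + l) * sgn l (i + j) * (sgn j l * sgn i k)) i j k l

/-- On homogeneous elements each axiom is that of A up to a sign. Where ε appears, either the total
parity is even and the sign is trivial, or ε vanishes. -/
theorem isBraidedHopfAlgebra : IsBraidedHopfAlgebra superR (coact π) (antipode π) where
  coaction := isLeftCoaction_coact
  one_colinear := by
    rw [← of_one, coact_of bideg_one]; rfl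
  mul_colinear := linearMap_ext₂ fun i j k l a ha b hb => by
    simp only [LinearMap.comp_apply, LinearMap.mul'_apply, of_mul_of_mem ha hb, map_smul,
      coact_of (bideg_mul ha hb), tensorCoaction_of ha hb, TensorProduct.map_tmul,
      LinearMap.id_apply, TensorProduct.tmul_smul]
    rw [add_add_add_comm]
  counit_colinear := linearMap_ext fun i j a ha => by
    simp only [LinearMap.comp_apply, trivialCoaction, TensorProduct.mk_apply, counit_of,
      coact_of ha, TensorProduct.map_tmul, LinearMap.id_apply]
    by_cases hij : i = j
    · rw [hij, add_self_zmod_two, gl_zero]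
    · simp [counit_eq_zero_of_mem hij ha]
  comul_colinear := linearMap_ext fun i j a ha => by
    obtain ⟨s, x, y, hx, hy, h⟩ := exists_homogeneous_repr ha
    simp only [LinearMap.comp_apply, comul_of_eq_sum h, map_sum, tensorCoaction_of (hx _) (hy _),
      coact_of ha, TensorProduct.map_tmul, LinearMap.id_apply, TensorProduct.tmul_sum]
    refine Finset.sum_congr rfl fun t _ => ?_
    rw [(by decide : ∀ i m j : ZMod 2, i + m + (m + j) = i + j)]
  antipode_colinear := linearMap_ext fun i j a ha => by
    simp only [LinearMap.comp_apply, antipode_of ha, map_smul, coact_of ha,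
      coact_of (antipode_mem ha), TensorProduct.map_tmul, LinearMap.id_apply,
      TensorProduct.tmul_smul, add_comm j i]
  counit_one := by rw [← of_one, counit_of]; simp
  counit_mul := by
    have h : (Coalgebra.counit : Transmutation π →ₗ[ℂ] ℂ) ∘ₗ LinearMap.mul' ℂ (Transmutation π) =
        LinearMap.mul' ℂ ℂ ∘ₗ TensorProduct.map Coalgebra.counit Coalgebra.counit :=
      linearMap_ext₂ fun i j k l a ha b hb => by
        simp only [LinearMap.comp_apply, LinearMap.mul'_apply, of_mul_of_mem ha hb, map_smul,
          counit_of, TensorProduct.map_tmul, Bialgebra.counit_mul]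
        by_cases hij : k = l
        · rw [hij, add_self_zmod_two, sgn_zero_right]; simp
        · simp [counit_eq_zero_of_mem hij hb]
    exact fun b c => LinearMap.congr_fun h (b ⊗ₜ c)
  comul_one := by
    rw [← of_one, comul_of, Bialgebra.comul_one]; rfl
  comul_mul := linearMap_ext₂ fun i j k l a ha b hb => by
    obtain ⟨s, x, y, hx, hy, hs⟩ := exists_homogeneous_repr ha
    obtain ⟨s', x', y', hx', hy', hs'⟩ := exists_homogeneous_repr hb
    have hab : Coalgebra.comul (R := ℂ) (a * b) =
        ∑ t ∈ s, ∑ u ∈ s', (x t * x' u) ⊗ₜ[ℂ] (y t * y' u) := by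
      simp only [Bialgebra.comul_mul, hs, hs', Finset.sum_mul, Finset.mul_sum,
        Algebra.TensorProduct.tmul_mul_tmul]
      exact Finset.sum_comm
    simp only [LinearMap.comp_apply, LinearMap.mul'_apply, of_mul_of_mem ha hb, map_smul,
      comul_of, hab, TensorProduct.map_tmul, hs, hs', map_sum, TensorProduct.sum_tmul,
      TensorProduct.tmul_sum, braidedTensorMul, applyMiddle, LinearEquiv.coe_coe,
      TensorProduct.assoc_tmul, TensorProduct.assoc_symm_tmul, LinearMap.id_apply,
      braiding_of (hy _) (hx' _), TensorProduct.smul_tmul', TensorProduct.tmul_smul,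
      of_mul_of_mem (hy _) (hy' _), Finset.smul_sum]
    rw [Finset.sum_comm]
    refine Finset.sum_congr rfl fun u _ => Finset.sum_congr rfl fun t _ => ?_
    rw [smul_mul_assoc, of_mul_of_mem (hx t) (hx' u), smul_smul, smul_smul]
    congr 2
    -- With intermediate degrees m and n, the right side collects the signs of the product of second
    -- legs, the braiding, and the product of first legs. Their exponents add up to j(k + l) mod 2,
    -- independently of m and n.
    exact_mod_cast (by decide : ∀ j k l m n : ZMod 2, sgn j (k + l) =
      sgn j (n + l) * sgn (m + j) (k + n) * sgn m (k + n)) j k l t.1 u.1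
  antipode_left := linearMap_ext fun i j a ha => by
    obtain ⟨s, x, y, hx, hy, h⟩ := exists_homogeneous_repr ha
    -- The sign of the antipode times that of the product does not depend on the intermediate degree
    -- m, so it leaves the sum.
    have e : ∀ i m j : ZMod 2, sgn i (i + m) * sgn i (m + j) = sgn i (i + j) := by decide
    simp only [LinearMap.comp_apply, comul_of_eq_sum h, map_sum, TensorProduct.map_tmul,
      antipode_of (hx _), LinearMap.id_apply, LinearMap.mul'_apply, smul_mul_assoc,
      of_mul_of_mem (antipode_mem (hx _)) (hy _), smul_smul, ← Int.cast_mul, e]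
    rw [← Finset.smul_sum, ← map_sum, sum_antipode_mul h, counit_of, map_smul, of_one,
      Algebra.linearMap_apply, Algebra.algebraMap_eq_smul_one]
    by_cases hij : i = j
    · rw [hij, add_self_zmod_two, sgn_zero_right]; simp
    · simp [counit_eq_zero_of_mem hij ha]
  antipode_right := linearMap_ext fun i j a ha => by
    obtain ⟨s, x, y, hx, hy, h⟩ := exists_homogeneous_repr ha
    have e : ∀ m j : ZMod 2, sgn m (m + j) * sgn m (j + m) = 1 := by decide
    simp only [LinearMap.comp_apply, comul_of_eq_sum h, map_sum, TensorProduct.map_tmul,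
      antipode_of (hy _), LinearMap.id_apply, LinearMap.mul'_apply, mul_smul_comm,
      of_mul_of_mem (hx _) (antipode_mem (hy _)), smul_smul, ← Int.cast_mul, e]
    rw [← Finset.smul_sum, ← map_sum, sum_mul_antipode h, counit_of, map_smul, of_one,
      Algebra.linearMap_apply, Algebra.algebraMap_eq_smul_one]
    simp

/-- `π` is supported on the bidegrees (i, i), which have even parity; there the twists of product
and antipode are trivial, so the homomorphism properties of `π` carry over. -/
theorem isBraidedHopfHom_proj : IsBraidedHopfHom (coact π) (antipode π)
    (trivialCoaction CZ2 CZ2) (HopfAlgebra.antipode ℂ) (proj π) where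
  colinear := linearMap_ext fun i j a ha => by
    simp only [LinearMap.comp_apply, proj_of, coact_of ha, TensorProduct.map_tmul,
      LinearMap.id_apply, trivialCoaction, TensorProduct.mk_apply]
    by_cases hij : i = j
    · rw [hij, add_self_zmod_two, gl_zero]
    · simp [map_of_mem_left ha, counit_eq_zero_of_mem hij ha]
  map_one := by rw [← of_one, proj_of, map_one]
  map_mul := by
    have h : proj π ∘ₗ LinearMap.mul' ℂ (Transmutation π) =
        LinearMap.mul' ℂ CZ2 ∘ₗ TensorProduct.map (proj π) (proj π) :=
      linearMap_ext₂ fun i j k l a ha b hb => by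
        simp only [LinearMap.comp_apply, LinearMap.mul'_apply, of_mul_of_mem ha hb, map_smul,
          proj_of, TensorProduct.map_tmul, map_mul]
        by_cases hij : k = l
        · rw [hij, add_self_zmod_two, sgn_zero_right]; simp
        · simp [map_of_mem_left hb, counit_eq_zero_of_mem hij hb]
    exact fun b c => LinearMap.congr_fun h (b ⊗ₜ c)
  counit_comp := linearMap_ext fun i j a ha => by
    simp only [LinearMap.comp_apply, proj_of, counit_of, CoalgHomClass.counit_comp_apply]
  comul_comp := linearMap_ext fun i j a ha => by
    simp only [LinearMap.comp_apply, proj_of, comul_of, TensorProduct.map_map]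
    exact (CoalgHomClass.map_comp_comul_apply π a).symm
  antipode_comp := linearMap_ext fun i j a ha => by
    have h : π (HopfAlgebra.antipode ℂ a) = Coalgebra.counit (R := ℂ) a • gl j := by
      rw [map_of_mem_left (antipode_mem ha), HopfAlgebra.counit_antipode]
    simp only [LinearMap.comp_apply, proj_of, antipode_of ha, map_smul, h]
    rw [map_of_mem_right ha, map_smul, antipode_gl]
    by_cases hij : i = j
    · rw [hij, add_self_zmod_two, sgn_zero_right]; simp
    · simp [counit_eq_zero_of_mem hij ha]

theorem proj_surjective (hπ : Function.Surjective π) : Function.Surjective (proj π) := by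
  intro h
  obtain ⟨a, rfl⟩ := hπ h
  exact ⟨of π a, proj_of a⟩

end Transmutation

/-! ### The diagonal of C(ℤ₂) ⊗ C(ℤ₂), and C(ℤ₂) as a trivially graded Hopf algebra. -/

/-- The functional on `C(ℤ₂) ⊗ C(ℤ₂)` with the value `0` on `gⁱ ⊗ gⁱ` and `1` on the other
`gⁱ ⊗ gʲ`. -/
noncomputable def offDiag : CZ2 ⊗[ℂ] CZ2 →ₗ[ℂ] ℂ :=
  LinearMap.mul' ℂ ℂ ∘ₗ TensorProduct.map Coalgebra.counit Coalgebra.counit -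
    ∑ i, LinearMap.mul' ℂ ℂ ∘ₗ TensorProduct.map (coeffL i) (coeffL i)

theorem offDiag_gl (i j : ZMod 2) : offDiag (gl i ⊗ₜ gl j) = if i = j then 0 else 1 := by
  by_cases h : i = j <;> simp [offDiag, coeffL_gl, h]

theorem offDiag_of_mem_diagonalPart {d : CZ2 ⊗[ℂ] CZ2} (hd : d ∈ diagonalPart CZ2) :
    offDiag d = 0 := by
  obtain ⟨h, rfl⟩ := hd.1
  refine LinearMap.congr_fun (f := offDiag ∘ₗ Coalgebra.comul) (g := 0) (CZ2_ext fun i => ?_) h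
  simp [offDiag_gl]

/-- C(ℤ₂) is cocommutative, so intersecting with the flipped image removes nothing. -/
theorem comul_mem_diagonalPart (h : CZ2) :
    Coalgebra.comul (R := ℂ) h ∈ diagonalPart CZ2 := by
  refine ⟨⟨h, rfl⟩, Coalgebra.comul h, ⟨h, rfl⟩, ?_⟩
  revert h
  refine LinearMap.congr_fun (f := (TensorProduct.comm ℂ CZ2 CZ2).toLinearMap ∘ₗ Coalgebra.comul)
    (CZ2_ext fun i => ?_)
  simp

theorem CZ2_ext₂ {M : Type*} [AddCommGroup M] [Module ℂ M] {f g : CZ2 ⊗[ℂ] CZ2 →ₗ[ℂ] M}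
    (h : ∀ i j, f (gl i ⊗ₜ gl j) = g (gl i ⊗ₜ gl j)) : f = g :=
  TensorProduct.ext (CZ2_ext fun i => CZ2_ext fun j => h i j)

theorem braiding_trivialCoaction (h k : CZ2) : braiding superR (trivialCoaction CZ2 CZ2)
    (trivialCoaction CZ2 CZ2) (h ⊗ₜ k) = k ⊗ₜ h := by
  have e : superR 1 1 = 1 := by simpa [sgn_zero_left, gl_zero] using superR_gl 0 0
  simp [braiding, trivialCoaction, e]

theorem isBraidedCommutative_trivialCoaction :
    IsBraidedCommutative superR (trivialCoaction CZ2 CZ2) :=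
  TensorProduct.ext' fun h k => by simp [braiding_trivialCoaction, mul_comm]

theorem isBraidedHopfAlgebra_trivialCoaction : IsBraidedHopfAlgebra superR
    (trivialCoaction CZ2 CZ2) (HopfAlgebra.antipode ℂ) where
  coaction :=
    { coassoc := LinearMap.ext fun h => by simp [trivialCoaction, Algebra.TensorProduct.one_def]
      counit := LinearMap.ext fun h => by simp [trivialCoaction] }
  one_colinear := rfl
  mul_colinear := TensorProduct.ext' fun h k => by simp [trivialCoaction, tensorCoaction]
  counit_colinear := LinearMap.ext fun h => by simp [trivialCoaction]
  comul_colinear := CZ2_ext fun i => by simp [trivialCoaction, tensorCoaction]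
  antipode_colinear := LinearMap.ext fun h => by simp [trivialCoaction]
  counit_one := Bialgebra.counit_one
  counit_mul := Bialgebra.counit_mul
  comul_one := Bialgebra.comul_one
  comul_mul := CZ2_ext₂ fun i j => by
    simp [gl_mul, braidedTensorMul, applyMiddle, braiding_trivialCoaction]
  antipode_left := HopfAlgebra.mul_antipode_rTensor_comul
  antipode_right := HopfAlgebra.mul_antipode_lTensor_comul

/-! ### The bosonization and the embedding of A. -/

namespace Transmutation

theorem bos_ext {M : Type*} [AddCommGroup M] [Module ℂ M]
    {f g : Transmutation π ⊗[ℂ] CZ2 →ₗ[ℂ] M}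
    (h : ∀ i j, ∀ a ∈ bideg π i j, ∀ p, f (of π a ⊗ₜ gl p) = g (of π a ⊗ₜ gl p)) : f = g := by
  refine TensorProduct.ext (linearMap_ext fun i j a ha => CZ2_ext fun p => ?_)
  exact h i j a ha p

/-- One sign comes from moving b past gᵖ, the other from the twisted product. They cancel exactly
when p = j, as on the image of the embedding. -/
theorem bosMul_of {i j k l : ZMod 2} {a b : A} (ha : a ∈ bideg π i j) (hb : b ∈ bideg π k l)
    (p q : ZMod 2) :
    bosMul superR (coact π) ((of π a ⊗ₜ gl p) ⊗ₜ (of π b ⊗ₜ gl q)) =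
      ((sgn (k + l) p * sgn j (k + l) : ℤ) : ℂ) • (of π (a * b) ⊗ₜ gl (p + q)) := by
  simp [bosMul, braidedTensorMul, applyMiddle, braiding, coact_of hb, superR_gl,
    TensorProduct.smul_tmul', of_mul_of_mem ha hb, gl_mul, smul_smul]

theorem bosComul_of {j : ZMod 2} {a : A} (p : ZMod 2) {s : Finset (ZMod 2 × A × A)}
    {x y : ZMod 2 × A × A → A} (hy : ∀ t, y t ∈ bideg π t.1 j)
    (h : Coalgebra.comul (R := ℂ) a = ∑ t ∈ s, x t ⊗ₜ[ℂ] y t) :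
    bosComul (coact π) (of π a ⊗ₜ gl p) =
      ∑ t ∈ s, (of π (x t) ⊗ₜ gl (t.1 + j + p)) ⊗ₜ (of π (y t) ⊗ₜ gl p) := by
  simp [bosComul, comul_of_eq_sum h, applyMiddle, coactMul, coact_of (hy _), gl_mul,
    TensorProduct.sum_tmul]

theorem bosCounit_comul : (TensorProduct.lid ℂ _).toLinearMap ∘ₗ
    TensorProduct.map (bosCounit (Transmutation π) CZ2) LinearMap.id ∘ₗ bosComul (coact π) =
      LinearMap.id := by
  refine bos_ext fun i j a ha p => ?_
  obtain ⟨s, x, y, hx, hy, h⟩ := exists_homogeneous_repr ha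
  simp only [LinearMap.comp_apply, bosComul_of p hy h, map_sum, TensorProduct.map_tmul, bosCounit,
    counit_of, counit_gl, LinearMap.mul'_apply, mul_one, LinearMap.id_apply, LinearEquiv.coe_coe,
    TensorProduct.lid_tmul]
  conv_rhs => rw [← sum_counit_smul_right h]
  simp [TensorProduct.sum_tmul, TensorProduct.smul_tmul']

variable (π) in
/-- The embedding `a ↦ a₁ ⊗ π(a₂)` of `A` into the bosonization of its transmutation. -/
noncomputable def embed : A →ₗ[ℂ] Transmutation π ⊗[ℂ] CZ2 :=
  TensorProduct.map (of π).toLinearMap LinearMap.id ∘ₗ (coactR π).toLinearMap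

/-- The group-like factor records the right degree; the image of the embedding is the sum of the
A_{ij} ⊗ gʲ. -/
theorem embed_of_mem {i j : ZMod 2} {a : A} (ha : a ∈ bideg π i j) :
    embed π a = of π a ⊗ₜ gl j := by
  simp [embed, (mem_bideg.1 ha).2]

theorem embed_injective : Function.Injective (embed π) := by
  have h : (of π).symm.toLinearMap ∘ₗ (TensorProduct.rid ℂ _).toLinearMap ∘ₗ
      TensorProduct.map LinearMap.id Coalgebra.counit ∘ₗ embed π = LinearMap.id :=
    linearMap_ext_bideg (π := π) fun i j a ha => by simp [embed_of_mem ha]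
  refine Function.Injective.of_comp (f := (of π).symm.toLinearMap ∘ₗ
    (TensorProduct.rid ℂ _).toLinearMap ∘ₗ TensorProduct.map LinearMap.id Coalgebra.counit) ?_
  intro a b hab
  exact (LinearMap.congr_fun h a).symm.trans (hab.trans (LinearMap.congr_fun h b))

theorem embed_mul (a b : A) :
    embed π (a * b) = bosMul superR (coact π) (embed π a ⊗ₜ embed π b) := by
  induction a using induction_bideg (π := π) with
  | add a a' h h' => simp [add_mul, TensorProduct.add_tmul, h, h']
  | hom i j a ha =>
  induction b using induction_bideg (π := π) with
  | add a a' h h' => simp [mul_add, TensorProduct.tmul_add, h, h']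
  | hom k l b hb =>
  rw [embed_of_mem ha, embed_of_mem hb, embed_of_mem (bideg_mul ha hb), bosMul_of ha hb,
    (by decide : ∀ i j : ZMod 2, sgn i j * sgn j i = 1)]
  simp

theorem bosCounit_embed : bosCounit (Transmutation π) CZ2 ∘ₗ embed π = Coalgebra.counit :=
  linearMap_ext_bideg (π := π) fun i j a ha => by simp [embed_of_mem ha, bosCounit, counit_of]

/-- The second leg y in A_{mj} has parity m + j, so the group-like factor of the first leg is
g^{m+j+j} = gᵐ, which is the right degree of that leg. -/
theorem bosComul_embed : bosComul (coact π) ∘ₗ embed π =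
    TensorProduct.map (embed π) (embed π) ∘ₗ Coalgebra.comul :=
  linearMap_ext_bideg (π := π) fun i j a ha => by
    obtain ⟨s, x, y, hx, hy, h⟩ := exists_homogeneous_repr ha
    simp only [LinearMap.comp_apply, embed_of_mem ha, bosComul_of j hy h, h, map_sum,
      TensorProduct.map_tmul, embed_of_mem (hx _), embed_of_mem (hy _), add_assoc,
      add_self_zmod_two, add_zero]

/-- The coaction turns gʲ into gⁱ, the right degree of S(a), and the braiding sign cancels the sign
built into the antipode of the transmutation. -/
theorem bosAntipode_embed : bosAntipode superR (coact π) (antipode π) ∘ₗ embed π =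
    embed π ∘ₗ HopfAlgebra.antipode ℂ :=
  linearMap_ext_bideg (π := π) fun i j a ha => by
    have e : i + j + j = i := by rw [add_assoc, add_self_zmod_two, add_zero]
    have e2 := (by decide : ∀ i j : ZMod 2, sgn i (i + j) * sgn (j + i) i = 1) i j
    have e3 : (sgn i (i + j) : ℂ) * (sgn (j + i) i : ℂ) = 1 := by exact_mod_cast e2
    simp [embed_of_mem ha, embed_of_mem (antipode_mem ha), bosAntipode, braiding, coactMul,
      coact_of ha, gl_mul, e, antipode_of ha, coact_of (antipode_mem ha), superR_gl, smul_smul, e3]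

theorem bosProj_embed (a : A) : bosProj (Transmutation π) CZ2 (embed π a) = π a := by
  revert a
  refine LinearMap.congr_fun (f := bosProj (Transmutation π) CZ2 ∘ₗ embed π)
    (g := ((π : A →ₗc[ℂ] CZ2) : A →ₗ[ℂ] CZ2)) (linearMap_ext_bideg (π := π) fun i j a ha => ?_)
  simp [embed_of_mem ha, bosProj, counit_of, map_of_mem_right ha]

/-! ### The image of the embedding is the spin-statistics reduction. -/

theorem map_proj_embed : TensorProduct.map (proj π) LinearMap.id ∘ₗ embed π =
    Coalgebra.comul ∘ₗ ((π : A →ₗc[ℂ] CZ2) : A →ₗ[ℂ] CZ2) :=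
  linearMap_ext_bideg (π := π) fun i j a ha => by
    simp [embed_of_mem ha, proj_of, map_of_mem_right ha, TensorProduct.smul_tmul']

theorem satisfiesSpinStatistics_range_embed :
    SatisfiesSpinStatistics (coact π) (proj π) (LinearMap.range (embed π)) := by
  rw [SatisfiesSpinStatistics, ← LinearMap.range_comp]
  -- By `map_proj_embed` the middle leg is Δ(π(a₂)), so the whole map is a₁ ⊗ a₂ ⊗ a₃ followed by
  -- maps into the three subspaces.
  let c : A →ₗ[ℂ] diagonalPart CZ2 := LinearMap.codRestrict (diagonalPart CZ2)
    (Coalgebra.comul ∘ₗ ((π : A →ₗc[ℂ] CZ2) : A →ₗ[ℂ] CZ2)) fun a => comul_mem_diagonalPart (π a)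
  have h : (TensorProduct.map LinearMap.id (TensorProduct.map (TensorProduct.map (proj π)
        LinearMap.id) LinearMap.id) ∘ₗ
      TensorProduct.map LinearMap.id (bosComul (coact π)) ∘ₗ bosComul (coact π)) ∘ₗ embed π =
      TensorProduct.map (LinearMap.range (embed π)).subtype
        (TensorProduct.map (diagonalPart CZ2).subtype (LinearMap.range (embed π)).subtype) ∘ₗ
      TensorProduct.map (embed π).rangeRestrict
        (TensorProduct.map c (embed π).rangeRestrict ∘ₗ Coalgebra.comul) ∘ₗ
        Coalgebra.comul := by
    have h1 (a : A) : TensorProduct.map (TensorProduct.map (proj π) LinearMap.id) LinearMap.id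
        (bosComul (coact π) (embed π a)) =
        TensorProduct.map (diagonalPart CZ2).subtype (LinearMap.range (embed π)).subtype
          (TensorProduct.map c (embed π).rangeRestrict (Coalgebra.comul a)) := by
      rw [← LinearMap.comp_apply (bosComul _), bosComul_embed, LinearMap.comp_apply,
        TensorProduct.map_map, TensorProduct.map_map, map_proj_embed]
      rfl
    have h2 : (TensorProduct.map LinearMap.id (TensorProduct.map (TensorProduct.map (proj π)
        LinearMap.id) LinearMap.id) ∘ₗ TensorProduct.map LinearMap.id (bosComul (coact π))) ∘ₗ
        TensorProduct.map (embed π) (embed π) =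
        TensorProduct.map (LinearMap.range (embed π)).subtype
          (TensorProduct.map (diagonalPart CZ2).subtype (LinearMap.range (embed π)).subtype) ∘ₗ
        TensorProduct.map (embed π).rangeRestrict
          (TensorProduct.map c (embed π).rangeRestrict ∘ₗ Coalgebra.comul) :=
      TensorProduct.ext' fun a b => by
        simp only [LinearMap.comp_apply, TensorProduct.map_tmul, h1]
        rfl
    rw [← LinearMap.comp_assoc (bosComul _), LinearMap.comp_assoc, bosComul_embed,
      ← LinearMap.comp_assoc, h2, LinearMap.comp_assoc]
  rw [h]
  exact LinearMap.range_comp_le_range _ _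

variable (π) in
/-- The left inverse `a ⊗ gᵖ ↦ δ(j, p) a`, for `a` in `bideg π i j`, of `embed π`. -/
noncomputable def unembed : Transmutation π ⊗[ℂ] CZ2 →ₗ[ℂ] A :=
  TensorProduct.lift ((homMap π fun _ j => LinearMap.smulRightₗ (coeffL j)) ∘ₗ
    (of π).symm.toLinearMap)

/-- For a in A_{ij}, the first leg of Δ(a ⊗ gᵖ) goes under σ ⊗ id to multiples of gᵐ ⊗ g^{m+j+p}.
This is off-diagonal exactly when p ≠ j, and then the counit law restores a ⊗ gᵖ. The result is the
projection killing the image of the embedding. -/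
theorem offDiag_bosComul : (TensorProduct.lid ℂ _).toLinearMap ∘ₗ
    TensorProduct.map (offDiag ∘ₗ TensorProduct.map (proj π) LinearMap.id) LinearMap.id ∘ₗ
      bosComul (coact π) = LinearMap.id - embed π ∘ₗ unembed π := by
  refine bos_ext fun i j a ha p => ?_
  obtain ⟨s, x, y, hx, hy, h⟩ := exists_homogeneous_repr ha
  have e : ∀ m j p : ZMod 2, m = m + j + p ↔ p = j := by decide
  have h1 : embed π (unembed π (of π a ⊗ₜ gl p)) = if p = j then of π a ⊗ₜ gl p else 0 := by
    by_cases hp : p = j <;> simp [unembed, homMap_of_mem _ ha, coeffL_gl, hp, embed_of_mem ha]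
  simp only [LinearMap.comp_apply, bosComul_of p hy h, map_sum, TensorProduct.map_tmul, proj_of,
    map_of_mem_right (hx _), LinearMap.id_apply, ← TensorProduct.smul_tmul', map_smul, offDiag_gl,
    LinearEquiv.coe_coe, TensorProduct.lid_tmul, e, LinearMap.sub_apply, h1]
  by_cases hp : p = j
  · simp [hp]
  · simp only [hp, if_false, sub_zero]
    conv_rhs => rw [← sum_counit_smul_right h]
    simp [TensorProduct.sum_tmul, TensorProduct.smul_tmul']

theorem isSpinStatisticsReduction_range_embed :
    IsSpinStatisticsReduction (coact π) (proj π) (LinearMap.range (embed π)) := by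
  refine ⟨satisfiesSpinStatistics_range_embed, fun W hW w hw => ?_⟩
  -- Ψ = ε ⊗ `offDiag` ⊗ id. It vanishes on W ⊗ (Δ H ∩ τ(Δ H)) ⊗ W, but on the spin-statistics
  -- expression of w it gives w - `embed π` (`unembed π` w); hence w lies in the image.
  let Ψ : (Transmutation π ⊗[ℂ] CZ2) ⊗[ℂ] ((CZ2 ⊗[ℂ] CZ2) ⊗[ℂ] (Transmutation π ⊗[ℂ] CZ2)) →ₗ[ℂ]
      Transmutation π ⊗[ℂ] CZ2 := (TensorProduct.lid ℂ _).toLinearMap ∘ₗ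
    TensorProduct.map (bosCounit (Transmutation π) CZ2)
      ((TensorProduct.lid ℂ _).toLinearMap ∘ₗ TensorProduct.map offDiag LinearMap.id)
  have h1 : Ψ ∘ₗ TensorProduct.map W.subtype
      (TensorProduct.map (diagonalPart CZ2).subtype W.subtype) = 0 := by
    ext w d w'
    simp [Ψ, offDiag_of_mem_diagonalPart d.2]
  have h2 : Ψ ∘ₗ TensorProduct.map LinearMap.id (TensorProduct.map (TensorProduct.map (proj π)
        LinearMap.id) LinearMap.id) ∘ₗ TensorProduct.map LinearMap.id (bosComul (coact π)) =
      (LinearMap.id - embed π ∘ₗ unembed π) ∘ₗ (TensorProduct.lid ℂ _).toLinearMap ∘ₗ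
        TensorProduct.map (bosCounit (Transmutation π) CZ2) LinearMap.id := by
    rw [← offDiag_bosComul]
    refine TensorProduct.ext' fun u v => ?_
    simp only [Ψ, LinearMap.comp_apply, TensorProduct.map_tmul, LinearMap.id_apply,
      LinearEquiv.coe_coe, TensorProduct.lid_tmul, map_smul, TensorProduct.map_map,
      LinearMap.id_comp]
  obtain ⟨z, hz⟩ := hW ⟨w, hw, rfl⟩
  have h3 := LinearMap.congr_fun h2 (bosComul (coact π) w)
  have h4 := LinearMap.congr_fun (bosCounit_comul (π := π)) w
  have h5 := LinearMap.congr_fun h1 z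
  simp only [LinearMap.comp_apply] at h3 h4 h5 hz
  rw [h4, ← hz, h5] at h3
  exact ⟨unembed π w, (sub_eq_zero.1 h3.symm).symm⟩

theorem isIsoOntoReduction_embed {RA : A →ₗ[ℂ] A →ₗ[ℂ] ℂ}
    (hπ : IsQuantumGroupExtension superR RA π) :
    IsIsoOntoReduction superR RA π (coact π) (antipode π) (proj π) (embed π) where
  injective := embed_injective
  map_one := by rw [embed_of_mem bideg_one]; rfl
  map_mul := embed_mul
  counit_comp := bosCounit_embed
  comul_comp := bosComul_embed
  antipode_comp := bosAntipode_embed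
  map_R a b := by
    rw [bosR, LinearMap.compl₁₂_apply, bosProj_embed, bosProj_embed, hπ.map_R]
  proj_comp := bosProj_embed
  range_eq := isSpinStatisticsReduction_range_embed

theorem isTriangularGroupExtension {RA : A →ₗ[ℂ] A →ₗ[ℂ] ℂ}
    (hπ : IsQuantumGroupExtension superR RA π) :
    IsTriangularGroupExtension superR (coact π) (antipode π)
      (trivialCoaction CZ2 CZ2) (HopfAlgebra.antipode ℂ) (proj π) where
  cotriangular := superR_isCotriangular
  hopf_source := isBraidedHopfAlgebra
  comm_source := isBraidedCommutative hπ
  hopf_target := isBraidedHopfAlgebra_trivialCoaction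
  comm_target := isBraidedCommutative_trivialCoaction
  hom := isBraidedHopfHom_proj
  surjective := proj_surjective hπ.surjective

end Transmutation

end SpinStat

theorem mainTheorem1 {A : Type u} [Ring A] [HopfAlgebra ℂ A]
    (RA : A →ₗ[ℂ] A →ₗ[ℂ] ℂ) (π : A →ₐc[ℂ] CZ2)
    (hπ : IsQuantumGroupExtension superR RA π) :
    ∃ (B : Type u) (_ : Ring B) (_ : Algebra ℂ B) (_ : Coalgebra ℂ B)
      (δ : B →ₗ[ℂ] CZ2 ⊗[ℂ] B) (S : B →ₗ[ℂ] B) (σ : B →ₗ[ℂ] CZ2),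
      IsTriangularGroupExtension superR δ S
        (trivialCoaction CZ2 CZ2) (HopfAlgebra.antipode ℂ) σ ∧
      ∃ ι : A →ₗ[ℂ] B ⊗[ℂ] CZ2, IsIsoOntoReduction superR RA π δ S σ ι :=
  ⟨Transmutation π, inferInstance, inferInstance, inferInstance, Transmutation.coact π,
    Transmutation.antipode π, Transmutation.proj π,
    Transmutation.isTriangularGroupExtension hπ,
    Transmutation.embed π, Transmutation.isIsoOntoReduction_embed hπ⟩
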